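/- **Setting.** $m$ agents $V=\{1,\dots,m\}$ are the vertices of a connected graph with graph distance $d_{vw}$; there are $k\ge 1$ actions with reward laws $P_a$ supported in $[0,1]$, means $\mu_a$, and gaps $\Delta_a=\max_b\mu_b-\mu_a$. In each round $t=1,2,\dots$ every agent $w$ plays an action $A^w_t$, and a raw reward is drawn from $P_{A^w_t}$, independently over agents and rounds. The agent receives only the privatised reward $X^w_t=f_\varepsilon(\text{raw reward})$, where $f_\varepsilon(x)=x+\mathrm{Laplace}(1/\varepsilon)$ with fresh independent noise (mean $0$, scale $1/\varepsilon$). The group regret is $R_G(n)=\sum_a\Delta_a\,\mathbb E\big[\sum_{w}\sum_{t=1}^n 1\{A^w_t=a\}\big]$. **LDP-UCB-L.** Suppose $s$ plays have been made, $N_a$ of them of action $a$, with empirical mean $\hat\mu_a$ of the received (privatised) rewards. If some action has $N_a\le 4\ln(s+1)$, play the first such action; otherwise play the first action maximising $$\hat\mu_a+\sqrt{\frac{2\ln(s+1)}{N_a}}+\sqrt{\frac{32\ln(s+1)}{\varepsilon^2N_a}}.$$ **QuACK with leader $v$ and single-agent algorithm $\pi$.** The leader keeps one first-in-first-out queue of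 rewards per action, initially empty. In round $t$ it receives $(A^w_{t-d_{vw}},X^w_{t-d_{vw}})$ from every $w\ne v$ with $d_{vw}<t$ (in the order of the agents' indices) and appends each reward to the queue of its action. As long as the queue of the action $a$ suggested by $\pi$ is nonempty, it removes the oldest reward $x$ from that queue and updates $\pi$ with $(a,x)$. When the queue of the suggested action is empty, the leader plays this action as $A^v_t$ and updates $\pi$ with $(A^v_t,X^v_t)$. A follower $w\ne v$ plays $A^w_t=A^v_{t-d_{vw}}$ if $t>d_{vw}$, and a uniformly random action otherwise. **Statement.** Let QuACK be run with an arbitrary leader $v$ and $\pi=$ LDP-UCB-L on the privatised rewards. 1. (Privacy.) For every $\varepsilon>0$ the mechanism $f_\varepsilon$ is $\varepsilon$-locally differentially private on $[0,1]$, i.e. $\mathbb P(f_\varepsilon(x)\in E)\le e^{\varepsilon}\,\mathbb P(f_\varepsilon(x')\in E)$ for all $x,x'\in[0,1]$ and measurable $E$. Moreover the whole interaction is $\varepsilon$-locally differentially private: if two tables of raw rewards in $[0,1]$ (one raw reward for each agent, round and action) differ only for one agent in one round, then the law of the transcript $(A^w_t,X^w_t)_{w,t}$ for the first table is at most $e^{\varepsilon}$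 times that for the second on every event. 2. (Regret.) For every $\varepsilon_0>0$ there is a constant $C>0$, depending only on $\varepsilon_0$, such that for all $0<\varepsilon\le\varepsilon_0$, all $m,k,n$ with $mn\ge 2$, all connected graphs, all leaders $v$ and all reward laws $P_a$ on $[0,1]$, $$R_G(n)\le C\Big(\sum_{a:\Delta_a>0}\frac{\ln(mn)}{\varepsilon^2\Delta_a}+\Big(\sum_{w=1}^m d_{vw}\Big)\sum_{a:\Delta_a>0}\Delta_a\Big).$$ -/

import Mathlib

open MeasureTheory

/-! ### The black-box reduction QuACK

Rounds are indexed by `t : ℕ`, so that `t` stands for round `t + 1`. The `m` agents are `Fin m`, the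
`k` actions are `Fin k`. A single-agent (deterministic) bandit algorithm maps the list of its past
action-feedback pairs, oldest first, to its next action. -/

namespace Quack

/-- A single-agent bandit algorithm with `k` actions. -/
abbrev Policy (k : ℕ) : Type := List (Fin k × ℝ) → Fin k

/-- The loop in which the leader feeds the algorithm `π` from the queues: as long as the queue of the
action suggested by `π` is nonempty, the oldest reward of that queue is removed and handed to `π`.
Returns the remaining queues and the new history of `π`. -/
def drain {k : ℕ} (π : Policy k) (Q : Fin k → List ℝ) (H : List (Fin k × ℝ)) :
    (Fin k → List ℝ) × List (Fin k × ℝ) :=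
  match h : Q (π H) with
  | [] => (Q, H)
  | x :: q => drain π (Function.update Q (π H) q) (H ++ [(π H, x)])
termination_by ∑ a, (Q a).length
decreasing_by
  refine Finset.sum_lt_sum (fun a _ => ?_) ⟨π H, Finset.mem_univ _, ?_⟩
  · by_cases ha : a = π H
    · subst ha; simp [h]
    · simp [Function.update_of_ne ha]
  · simp [h]

/-- The action of an agent at distance `δ` from the leader in round `t`, where `lead s` is the action
of the leader in round `s` and `coin` is the agent's own (uniformly random) action in round `t`: the
action of the leader `δ` rounds ago, or `coin` while no instruction has arrived yet. For `δ = 0`, the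
leader itself, this is `lead t`. -/
def relay {k : ℕ} (lead : ℕ → Fin k) (δ t : ℕ) (coin : Fin k) : Fin k :=
  if δ ≤ t then lead (t - δ) else coin

/-- What the leader stores: its own actions so far (`lead s` is meaningful only for the rounds `s`
already played), one queue of rewards per action, and the history fed to the bandit algorithm. -/
structure LeaderState (k : ℕ) where
  lead : ℕ → Fin k
  queue : Fin k → List ℝ
  hist : List (Fin k × ℝ)

/-- The action-reward pairs that reach the leader `v` at the start of round `t`: from each follower
`w ≠ v` at distance `d w ≤ t`, the pair of its round `t - d w`. The agents' rewards are read from the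
table `X`: agent `w` receives `X (s, w, a)` if it plays `a` in round `s`. -/
def messages {m k : ℕ} (d : Fin m → ℕ) (v : Fin m) (u : ℕ × Fin m → Fin k)
    (X : ℕ × Fin m × Fin k → ℝ) (lead : ℕ → Fin k) (t : ℕ) : List (Fin k × ℝ) :=
  ((List.finRange m).filter (fun w => w ≠ v ∧ d w ≤ t)).map fun w =>
    let s := t - d w
    let a := relay lead (d w) s (u (s, w))
    (a, X (s, w, a))

/-- Round `t` of the leader `v`: append the received rewards to the queues, feed `π` from the queues,
play the action then suggested by `π`, and feed `π` with the reward received for it. -/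
def leaderStep {m k : ℕ} (π : Policy k) (d : Fin m → ℕ) (v : Fin m) (u : ℕ × Fin m → Fin k)
    (X : ℕ × Fin m × Fin k → ℝ) (t : ℕ) (S : LeaderState k) : LeaderState k :=
  let M := messages d v u X S.lead t
  let D := drain π (fun a => S.queue a ++ (M.filter (fun p => p.1 = a)).map Prod.snd) S.hist
  let a := π D.2
  { lead := Function.update S.lead t a
    queue := D.1
    hist := D.2 ++ [(a, X (t, v, a))] }

/-- The state of the leader before round `t`. -/
def leaderState {m k : ℕ} [NeZero k] (π : Policy k) (d : Fin m → ℕ) (v : Fin m)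
    (u : ℕ × Fin m → Fin k) (X : ℕ × Fin m × Fin k → ℝ) : ℕ → LeaderState k
  | 0 => { lead := fun _ => 0, queue := fun _ => [], hist := [] }
  | t + 1 => leaderStep π d v u X t (leaderState π d v u X t)

/-- The action of agent `w` in round `t` when QuACK is run on the network `G` with leader `v` and
bandit algorithm `π`, with initial random actions `u` of the followers and reward table `X`. -/
noncomputable def action {m k : ℕ} [NeZero k] (π : Policy k) (G : SimpleGraph (Fin m)) (v : Fin m)
    (u : ℕ × Fin m → Fin k) (X : ℕ × Fin m × Fin k → ℝ) (t : ℕ) (w : Fin m) : Fin k :=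
  relay (leaderState π (G.dist v) v u X (t + 1)).lead (G.dist v w) t (u (t, w))

/-- Everything that is observed during the interaction: the action played and the reward received by
every agent in every round. -/
noncomputable def transcript {m k : ℕ} [NeZero k] (π : Policy k) (G : SimpleGraph (Fin m)) (v : Fin m)
    (u : ℕ × Fin m → Fin k) (X : ℕ × Fin m × Fin k → ℝ) : ℕ × Fin m → Fin k × ℝ :=
  fun p => (action π G v u X p.1 p.2, X (p.1, p.2, action π G v u X p.1 p.2))

/-- `∑ v, T_{av}(n)`: how often the agents together play `a` in the first `n` rounds. -/
noncomputable def groupPlays {m k : ℕ} [NeZero k] (π : Policy k) (G : SimpleGraph (Fin m)) (v : Fin m)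
    (u : ℕ × Fin m → Fin k) (X : ℕ × Fin m × Fin k → ℝ) (n : ℕ) (a : Fin k) : ℕ :=
  ∑ w : Fin m, ((Finset.range n).filter (fun t => action π G v u X t w = a)).card

end Quack

/-! ### Local differential privacy and the Laplace mechanism -/

namespace LDP

/-- `μ` and `ν` are probability measures and `μ E ≤ e^ε ν E` for all events `E`. -/
def EpsClose {β : Type*} [MeasurableSpace β] (ε : ℝ) (μ ν : Measure β) : Prop :=
  IsProbabilityMeasure μ ∧ IsProbabilityMeasure ν ∧
    ∀ E, MeasurableSet E → μ E ≤ ENNReal.ofReal (Real.exp ε) * ν E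

/-- A randomised mechanism, which answers the private input `x` by a sample of `M x`, is
`ε`-locally differentially private on the set `D` of inputs. -/
def IsLDP {α β : Type*} [MeasurableSpace β] (ε : ℝ) (D : Set α) (M : α → Measure β) : Prop :=
  ∀ x ∈ D, ∀ x' ∈ D, EpsClose ε (M x) (M x')

/-- The Laplace distribution with mean `0` and scale `1 / ε`. -/
noncomputable def laplace (ε : ℝ) : Measure ℝ :=
  volume.withDensity fun x => ENNReal.ofReal (ε / 2 * Real.exp (-(ε * |x|)))

/-- The privatising mechanism `x ↦ x + Laplace(1 / ε)`. -/
noncomputable def laplaceMechanism (ε : ℝ) (x : ℝ) : Measure ℝ :=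
  (laplace ε).map fun z => x + z

/-- The table of privatised rewards: each agent in each round receives its raw reward plus fresh
noise. -/
def privatise {m k : ℕ} (x : ℕ × Fin m × Fin k → ℝ) (z : ℕ × Fin m → ℝ) :
    ℕ × Fin m × Fin k → ℝ :=
  fun i => x i + z (i.1, i.2.1)

/-- Law of the followers' initial random actions: independent and uniform. -/
noncomputable def coinLaw (m k : ℕ) [NeZero k] : Measure (ℕ × Fin m → Fin k) :=
  Measure.infinitePi fun _ => (PMF.uniformOfFintype (Fin k)).toMeasure

/-- Law of the noise: independent Laplace variables, one per agent and round. -/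
noncomputable def noiseLaw (m : ℕ) (ε : ℝ) : Measure (ℕ × Fin m → ℝ) :=
  Measure.infinitePi fun _ => laplace ε

/-- Law of the table of raw rewards: independent, with law `P a` for action `a`. -/
noncomputable def rewardLaw (m : ℕ) {k : ℕ} (P : Fin k → Measure ℝ) :
    Measure (ℕ × Fin m × Fin k → ℝ) :=
  Measure.infinitePi fun i => P i.2.2

/-- Law of the transcript of QuACK, run on rewards privatised by the Laplace mechanism, when the raw
rewards are given by the table `x`. -/
noncomputable def transcriptLaw {m k : ℕ} [NeZero k] (π : Quack.Policy k) (G : SimpleGraph (Fin m))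
    (v : Fin m) (ε : ℝ) (x : ℕ × Fin m × Fin k → ℝ) : Measure (ℕ × Fin m → Fin k × ℝ) :=
  ((coinLaw m k).prod (noiseLaw m ε)).map fun p =>
    Quack.transcript π G v p.1 (privatise x p.2)

/-- An interactive protocol, whose transcript has law `L x` when the raw rewards (of agent `w` in
round `t` for action `a`) are `x (t, w, a) ∈ [0, 1]`, is `ε`-locally differentially private: replacing
the raw rewards of one agent in one round changes the probability of no event by more than a factor
`e^ε`. -/
def IsInteractiveLDP {m k : ℕ} {β : Type*} [MeasurableSpace β] (ε : ℝ)
    (L : (ℕ × Fin m × Fin k → ℝ) → Measure β) : Prop :=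
  ∀ x x' : ℕ × Fin m × Fin k → ℝ, (∀ i, x i ∈ Set.Icc 0 1) → (∀ i, x' i ∈ Set.Icc 0 1) →
    ∀ p : ℕ × Fin m, (∀ i, (i.1, i.2.1) ≠ p → x i = x' i) → EpsClose ε (L x) (L x')

/-! ### The single-agent algorithm LDP-UCB-L -/

/-- Number of plays of `a` in the history `H`. -/
def plays {k : ℕ} (H : List (Fin k × ℝ)) (a : Fin k) : ℕ :=
  H.countP (fun p => p.1 = a)

/-- Average of the (privatised) rewards of `a` in the history `H`. -/
noncomputable def empMean {k : ℕ} (H : List (Fin k × ℝ)) (a : Fin k) : ℝ :=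
  ((H.filter (fun p => p.1 = a)).map Prod.snd).sum / plays H a

/-- The index of LDP-UCB-L. The play to be decided has number `H.length + 1`. -/
noncomputable def ucb {k : ℕ} (ε : ℝ) (H : List (Fin k × ℝ)) (a : Fin k) : ℝ :=
  empMean H a + √(2 * Real.log (H.length + 1) / plays H a)
    + √(32 * Real.log (H.length + 1) / (ε ^ 2 * plays H a))

/-- The actions that have been played too rarely for the index to be a valid confidence bound. -/
noncomputable def underSampled {k : ℕ} (H : List (Fin k × ℝ)) : Finset (Fin k) :=
  Finset.univ.filter fun a => (plays H a : ℝ) ≤ 4 * Real.log (H.length + 1)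

/-- The actions of maximal index. -/
noncomputable def maximisers {k : ℕ} (ε : ℝ) (H : List (Fin k × ℝ)) : Finset (Fin k) :=
  Finset.univ.filter fun a => ∀ b, ucb ε H b ≤ ucb ε H a

lemma maximisers_nonempty {k : ℕ} [NeZero k] (ε : ℝ) (H : List (Fin k × ℝ)) :
    (maximisers ε H).Nonempty := by
  obtain ⟨a, ha⟩ := Finite.exists_max (ucb ε H)
  exact ⟨a, by simpa [maximisers] using ha⟩

/-- LDP-UCB-L: play an under-sampled action if there is one, and otherwise an action of maximal index
(ties are broken by taking the first such action). -/
noncomputable def ldpUcbL {k : ℕ} [NeZero k] (ε : ℝ) : Quack.Policy k := fun H =>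
  if h : (underSampled H).Nonempty then (underSampled H).min' h
  else (maximisers ε H).min' (maximisers_nonempty ε H)

/-! ### Group regret -/

/-- The sub-optimality gap `Δ_a`, for the raw rewards. -/
noncomputable def gap {k : ℕ} (P : Fin k → Measure ℝ) (a : Fin k) : ℝ :=
  (⨆ b, ∫ x, x ∂(P b)) - ∫ x, x ∂(P a)

/-- Joint law of raw rewards, initial random actions and noise. -/
noncomputable def law (m : ℕ) {k : ℕ} [NeZero k] (P : Fin k → Measure ℝ) (ε : ℝ) :
    Measure ((ℕ × Fin m × Fin k → ℝ) × (ℕ × Fin m → Fin k) × (ℕ × Fin m → ℝ)) :=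
  (rewardLaw m P).prod ((coinLaw m k).prod (noiseLaw m ε))

/-- The group regret `R_G(n) = ∑ a, Δ_a E[∑ v, T_{av}(n)]` of QuACK with leader `v` and bandit
algorithm `π` on rewards privatised by the Laplace mechanism. -/
noncomputable def groupRegret {m k : ℕ} [NeZero k] (π : Quack.Policy k) (G : SimpleGraph (Fin m))
    (v : Fin m) (P : Fin k → Measure ℝ) (ε : ℝ) (n : ℕ) : ℝ :=
  ∑ a, gap P a *
    ∫ ω, (Quack.groupPlays π G v ω.2.1 (privatise ω.1 ω.2.2) n a : ℝ) ∂(law m P ε)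

end LDP

/-! Privacy. Moving a Laplace density of scale 1/ε by at most 1 changes it by a factor of at most
e^ε. For the interaction, split according to the action a played at the altered place p. Shifting
the noise at p by the difference of the two raw rewards of a makes the two tables agree wherever a
reward is actually received. Since a run depends only on received rewards (`Quack.act_congr`), the
transcript is unchanged, and the shift of this single noise variable costs e^ε.

Regret, reduction. A queue is empty whenever its action is played by the leader, so after the
leader's last play of a every known reward of a has been fed to π. An agent at distance d can add at
most 2d plays of a outside this account. Hence the group count is at most the count in the history
of π plus 2 ∑ d (`Quack.sum_card_act_le`), and that history has length at most mn.

Regret, concentration. The queues reorder the rewards, so the estimates are controlled in order of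
arrival instead. Being first-in-first-out, the queues ensure that the first N rewards of b used by π
are the first N that arrived. Their exponential weight has expectation at most 1, because neither
the choice of action at a place nor anything that arrived earlier depends on the reward there
(`LDP.lintegral_weight_arrivals_le`). Markov's inequality and a union bound over N then bound the
probability of a bad estimate after s plays by a summable sequence. The Laplace moment generating
function exists only near 0, and forcing more than 4 log(s+1) plays keeps the exponential rate in a
safe range. Off the bad events the usual UCB argument allows O(log(mn)/(ε²Δ²)) plays for bounded ε.
-/

namespace Quack

/-! ### Bookkeeping of the queues -/

/-- The rewards of the action `a` in the list `H` of action-reward pairs, in order. -/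
def samples {k : ℕ} (H : List (Fin k × ℝ)) (a : Fin k) : List ℝ :=
  (H.filter (fun p => p.1 = a)).map Prod.snd

@[simp] lemma samples_nil {k : ℕ} (a : Fin k) : samples [] a = [] := rfl

@[simp] lemma samples_append {k : ℕ} (H H' : List (Fin k × ℝ)) (a : Fin k) :
    samples (H ++ H') a = samples H a ++ samples H' a := by
  simp [samples]

lemma samples_singleton {k : ℕ} (p : Fin k × ℝ) (a : Fin k) :
    samples [p] a = if p.1 = a then [p.2] else [] := by
  by_cases h : p.1 = a <;> simp [samples, h]

lemma samples_prefix {k : ℕ} {H H' : List (Fin k × ℝ)} (h : H <+: H') (a : Fin k) :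
    samples H a <+: samples H' a := by
  obtain ⟨L, rfl⟩ := h
  simp

lemma length_samples {k : ℕ} (H : List (Fin k × ℝ)) (a : Fin k) :
    (samples H a).length = LDP.plays H a := by
  simp [samples, LDP.plays, List.countP_eq_length_filter]

lemma sum_length_samples {k : ℕ} (H : List (Fin k × ℝ)) :
    ∑ a, (samples H a).length = H.length := by
  induction H using List.reverseRecOn with
  | nil => simp
  | append_singleton H p ih =>
    have h : ∀ a, (samples [p] a).length = if p.1 = a then 1 else 0 := fun a => by
      rw [samples_singleton]; split_ifs <;> rfl
    simp [Finset.sum_add_distrib, ih, h]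

/-- Every action in the history `H` is the one prescribed by `π`. -/
def Consistent {k : ℕ} (π : Policy k) (H : List (Fin k × ℝ)) : Prop :=
  ∀ H' p, H' ++ [p] <+: H → p.1 = π H'

lemma Consistent.append {k : ℕ} {π : Policy k} {H : List (Fin k × ℝ)} (h : Consistent π H) (x : ℝ) :
    Consistent π (H ++ [(π H, x)]) := by
  intro H' p hp
  rcases List.prefix_concat_iff.1 hp with h' | h'
  · obtain ⟨rfl, h2⟩ := List.append_inj' h' rfl
    simp only [List.cons.injEq, and_true] at h2
    simp [h2]
  · exact h _ _ h'

/-- Each pass moves the head of one queue to the end of the history, so for every action the fed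
rewards followed by the queued ones form an invariant list. This is where first-in-first-out enters.
-/
lemma drain_spec {k : ℕ} (π : Policy k) (Q : Fin k → List ℝ) (H : List (Fin k × ℝ)) :
    (drain π Q H).1 (π (drain π Q H).2) = [] ∧
    (∀ a, samples (drain π Q H).2 a ++ (drain π Q H).1 a = samples H a ++ Q a) ∧
    H <+: (drain π Q H).2 ∧
    (Consistent π H → Consistent π (drain π Q H).2) := by
  fun_induction drain π Q H with
  | case1 Q H h => exact ⟨h, fun _ => rfl, List.prefix_refl _, id⟩
  | case2 Q H x q h ih =>
    obtain ⟨h1, h2, h3, h4⟩ := ih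
    refine ⟨h1, fun a => ?_, (List.prefix_append _ _).trans h3, fun hc => h4 (hc.append x)⟩
    rw [h2, samples_append, samples_singleton]
    by_cases ha : π H = a
    · subst ha; simp [h]
    · simp [ha, Function.update_of_ne (Ne.symm ha)]

section run

variable {m k : ℕ} [NeZero k] (π : Policy k) (d : Fin m → ℕ) (v : Fin m)
  (u : ℕ × Fin m → Fin k) (X : ℕ × Fin m × Fin k → ℝ)

/-- The action of the leader in round `s`. -/
def leadAct (s : ℕ) : Fin k := (leaderState π d v u X (s + 1)).lead s

/-- The action of agent `c.2` in round `c.1`. -/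
def act (c : ℕ × Fin m) : Fin k := relay (leadAct π d v u X) (d c.2) c.1 (u c)

/-- The round-agent pairs whose rewards reach the leader at the start of round `t`. -/
def msgCells (t : ℕ) : List (ℕ × Fin m) :=
  ((List.finRange m).filter (fun w => w ≠ v ∧ d w ≤ t)).map fun w => (t - d w, w)

/-- The round-agent pairs whose rewards the leader knows before round `t`, in order of arrival. -/
def arrivals : ℕ → List (ℕ × Fin m)
  | 0 => []
  | t + 1 => arrivals t ++ msgCells d v t ++ [(t, v)]

/-- The action-reward pairs observed at the round-agent pairs in `L`. -/
def obs (L : List (ℕ × Fin m)) : List (Fin k × ℝ) :=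
  L.map fun c => (act π d v u X c, X (c.1, c.2, act π d v u X c))

@[simp] lemma obs_nil : obs π d v u X [] = [] := rfl

@[simp] lemma obs_append (L L' : List (ℕ × Fin m)) :
    obs π d v u X (L ++ L') = obs π d v u X L ++ obs π d v u X L' := by
  simp [obs]

lemma obs_singleton (c : ℕ × Fin m) :
    obs π d v u X [c] = [(act π d v u X c, X (c.1, c.2, act π d v u X c))] := rfl

variable {d v}

lemma mem_msgCells {t : ℕ} {c : ℕ × Fin m} :
    c ∈ msgCells d v t ↔ c.2 ≠ v ∧ c.1 + d c.2 = t := by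
  obtain ⟨s, w⟩ := c
  simp only [msgCells, List.mem_map, List.mem_filter, List.mem_finRange, Prod.mk.injEq]
  constructor
  · rintro ⟨w', h, rfl, rfl⟩
    simp at h
    exact ⟨h.1, by omega⟩
  · rintro ⟨h1, h2⟩
    refine ⟨w, by simpa using ⟨h1, by omega⟩, ?_, rfl⟩
    omega

/-- A follower's reward of round s is delivered in round s + d, and the leader's own, with d = 0, is
appended at the end of round s; one inequality covers both. -/
lemma mem_arrivals (hv : d v = 0) {t : ℕ} {c : ℕ × Fin m} :
    c ∈ arrivals d v t ↔ c.1 + d c.2 < t := by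
  induction t with
  | zero => simp [arrivals]
  | succ t ih =>
    simp only [arrivals, List.mem_append, ih, mem_msgCells, List.mem_singleton]
    obtain ⟨s, w⟩ := c
    by_cases hw : w = v
    · subst hw; simp [hv]; omega
    · simp [hw]; omega

lemma nodup_msgCells (t : ℕ) : (msgCells d v t).Nodup :=
  ((List.nodup_finRange m).filter _).map_on fun _ _ _ _ h => (Prod.mk.inj h).2

lemma length_arrivals_le (t : ℕ) : (arrivals d v t).length ≤ m * t := by
  induction t with
  | zero => simp [arrivals]
  | succ t ih =>
    have h : ((v :: (List.finRange m).filter (fun w => w ≠ v ∧ d w ≤ t)) : List (Fin m)).Nodup := by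
      rw [List.nodup_cons]
      exact ⟨by simp, (List.nodup_finRange m).filter _⟩
    have h' := h.length_le_card
    simp only [List.length_cons, Fintype.card_fin] at h'
    simp only [arrivals, msgCells, List.length_append, List.length_map, List.length_singleton]
    rw [mul_add, mul_one]
    omega

/-- Round t overwrites only entry t, so earlier instructions are final. -/
lemma lead_succ_of_lt {s t : ℕ} (h : s < t) :
    (leaderState π d v u X t).lead s = leadAct π d v u X s := by
  induction t, h using Nat.le_induction with
  | base => rfl
  | succ t h ih =>
    rw [← ih]
    simp [leaderState, leaderStep, Function.update_of_ne (show s ≠ t by omega)]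

/-- Stored instructions are meaningless from round t on; since followers have positive distance,
only earlier entries are read. -/
lemma messages_eq_obs (hd : ∀ w, w ≠ v → 0 < d w) (t : ℕ) :
    messages d v u X (leaderState π d v u X t).lead t = obs π d v u X (msgCells d v t) := by
  simp only [messages, obs, msgCells, List.map_map]
  refine List.map_congr_left fun w hw => ?_
  simp only [List.mem_filter, List.mem_finRange, true_and, decide_eq_true_eq] at hw
  have h : relay (leaderState π d v u X t).lead (d w) (t - d w) (u (t - d w, w)) =
      act π d v u X (t - d w, w) := by
    simp only [act, relay]
    split_ifs with h
    · exact lead_succ_of_lt π u X (by have := hd w hw.1; omega)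
    · rfl
  simp [h]

lemma act_leader (hv : d v = 0) (t : ℕ) : act π d v u X (t, v) = leadAct π d v u X t := by
  simp [act, relay, hv]

/-- The queues and the history after the leader has fed `π` from the queues in round `t`. -/
def drained (d : Fin m → ℕ) (v : Fin m) (t : ℕ) : (Fin k → List ℝ) × List (Fin k × ℝ) :=
  drain π (fun a => (leaderState π d v u X t).queue a ++
    samples (messages d v u X (leaderState π d v u X t).lead t) a) (leaderState π d v u X t).hist

lemma leadAct_eq (t : ℕ) : leadAct π d v u X t = π (drained π u X d v t).2 := by
  simp [leadAct, leaderState, leaderStep, drained, samples]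

lemma hist_succ (t : ℕ) : (leaderState π d v u X (t + 1)).hist =
    (drained π u X d v t).2 ++ [(leadAct π d v u X t, X (t, v, leadAct π d v u X t))] := by
  rw [leadAct_eq]; rfl

lemma queue_succ (t : ℕ) : (leaderState π d v u X (t + 1)).queue = (drained π u X d v t).1 := rfl

lemma queue_leadAct (t : ℕ) :
    (leaderState π d v u X (t + 1)).queue (leadAct π d v u X t) = [] := by
  rw [queue_succ, leadAct_eq]
  exact (drain_spec _ _ _).1

lemma hist_prefix_succ (t : ℕ) :
    (leaderState π d v u X t).hist <+: (leaderState π d v u X (t + 1)).hist := by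
  rw [hist_succ]
  exact (drain_spec _ _ _).2.2.1.trans (List.prefix_append _ _)

lemma hist_prefix {s t : ℕ} (h : s ≤ t) :
    (leaderState π d v u X s).hist <+: (leaderState π d v u X t).hist := by
  induction t, h using Nat.le_induction with
  | base => exact List.prefix_refl _
  | succ t _ ih => exact ih.trans (hist_prefix_succ π u X t)

lemma consistent_hist (t : ℕ) : Consistent π (leaderState π d v u X t).hist := by
  induction t with
  | zero => intro H' p h; simp [leaderState] at h
  | succ t ih =>
    rw [hist_succ, leadAct_eq]
    exact ((drain_spec _ _ _).2.2.2 ih).append _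

/-- Nothing gets lost: the received rewards of an action are those fed to `π`, followed by those still
queued. -/
lemma samples_obs_arrivals (hv : d v = 0) (hd : ∀ w, w ≠ v → 0 < d w) (t : ℕ) (a : Fin k) :
    samples (obs π d v u X (arrivals d v t)) a =
      samples (leaderState π d v u X t).hist a ++ (leaderState π d v u X t).queue a := by
  induction t with
  | zero => simp [arrivals, leaderState]
  | succ t ih =>
    have h := (drain_spec π (fun a => (leaderState π d v u X t).queue a ++
      samples (messages d v u X (leaderState π d v u X t).lead t) a)
      (leaderState π d v u X t).hist).2.1 a
    rw [← List.append_assoc, ← ih, messages_eq_obs π u X hd] at h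
    simp only [arrivals, obs_append, samples_append]
    rw [← h, hist_succ, queue_succ, samples_append, obs_singleton, act_leader π u X hv,
      samples_singleton]
    simp only
    split_ifs with ha
    -- The leader's own reward bypasses the queue. The order is still right because the queue of the
    -- played action is empty.
    · have h0 := queue_leadAct π u X (d := d) (v := v) t
      rw [queue_succ, ha] at h0
      rw [h0]
      simp only [drained, messages_eq_obs π u X hd] at h0
      rw [h0]
      simp [drained, messages_eq_obs π u X hd]
    · simp [drained, messages_eq_obs π u X hd]

lemma length_hist_le (hv : d v = 0) (hd : ∀ w, w ≠ v → 0 < d w) (t : ℕ) :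
    (leaderState π d v u X t).hist.length ≤ m * t := by
  refine le_trans ?_ (length_arrivals_le (d := d) (v := v) t)
  rw [← sum_length_samples, show (arrivals d v t).length = (obs π d v u X (arrivals d v t)).length by
    simp [obs], ← sum_length_samples]
  exact Finset.sum_le_sum fun a _ => by simp [samples_obs_arrivals π u X hv hd]

lemma plays_obs_arrivals (hv : d v = 0) (hd : ∀ w, w ≠ v → 0 < d w) (t : ℕ) (a : Fin k) :
    LDP.plays (obs π d v u X (arrivals d v t)) a =
      ∑ w, ((Finset.range (t - d w)).filter (fun s => act π d v u X (s, w) = a)).card := by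
  induction t with
  | zero => simp [arrivals, LDP.plays]
  | succ t ih =>
    have hmsg : LDP.plays (obs π d v u X (msgCells d v t)) a =
        ∑ w, if w ≠ v ∧ d w ≤ t ∧ act π d v u X (t - d w, w) = a then 1 else 0 := by
      simp only [LDP.plays, obs, msgCells, List.map_map, List.countP_map, List.countP_filter]
      rw [List.countP_eq_length_filter, ← Finset.card_filter]
      rw [← List.toFinset_card_of_nodup ((List.nodup_finRange m).filter _)]
      congr 1
      ext w
      simp
      tauto
    have hlead : LDP.plays (obs π d v u X [(t, v)]) a =
        ∑ w, if w = v ∧ act π d v u X (t, v) = a then 1 else 0 := by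
      simp only [LDP.plays, obs_singleton, List.countP_singleton]
      by_cases h : act π d v u X (t, v) = a <;> simp [h]
    have happ : ∀ H H' : List (Fin k × ℝ), LDP.plays (H ++ H') a = LDP.plays H a + LDP.plays H' a :=
      fun H H' => List.countP_append
    rw [arrivals, obs_append, obs_append, happ, happ, ih, hmsg, hlead, ← Finset.sum_add_distrib,
      ← Finset.sum_add_distrib]
    refine Finset.sum_congr rfl fun w _ => ?_
    by_cases hw : w = v
    · subst hw
      simp only [hv, Nat.sub_zero, Finset.range_add_one, Finset.filter_insert]
      by_cases h : act π d w u X (t, w) = a <;> simp [h]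
    · by_cases hle : d w ≤ t
      · rw [show t + 1 - d w = (t - d w) + 1 by omega, Finset.range_add_one, Finset.filter_insert]
        by_cases h : act π d v u X (t - d w, w) = a <;> simp [h, hw, hle]
      · simp [hle, hw, show t + 1 - d w = 0 by omega, show t - d w = 0 by omega]

/-- The group plays `a` at most `2 ∑ d` times more often than `a` occurs in the history of `π`. -/
lemma sum_card_act_le (hv : d v = 0) (hd : ∀ w, w ≠ v → 0 < d w) (n : ℕ) (a : Fin k) :
    ∑ w, ((Finset.range n).filter (fun t => act π d v u X (t, w) = a)).card ≤
      LDP.plays (leaderState π d v u X n).hist a + 2 * ∑ w, d w := by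
  by_cases hτ : ∃ s < n, leadAct π d v u X s = a
  -- τ is the leader's last play of a before round n. Afterwards the queue of a is empty, so
  -- everything known about a lies in the history.
  · obtain ⟨τ, hτn, hτa, hmax⟩ : ∃ τ < n, leadAct π d v u X τ = a ∧
        ∀ s < n, leadAct π d v u X s = a → s ≤ τ := by
      obtain ⟨s, hs, hsa⟩ := hτ
      have hne : ((Finset.range n).filter (fun s => leadAct π d v u X s = a)).Nonempty :=
        ⟨s, by simp [hs, hsa]⟩
      have hmem := Finset.max'_mem _ hne
      simp only [Finset.mem_filter, Finset.mem_range] at hmem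
      exact ⟨_, hmem.1, hmem.2, fun r hr hra => Finset.le_max' _ _ (by simp [hr, hra])⟩
    have h1 : LDP.plays (obs π d v u X (arrivals d v (τ + 1))) a ≤
        LDP.plays (leaderState π d v u X n).hist a := by
      rw [← length_samples, samples_obs_arrivals π u X hv hd, ← hτa, queue_leadAct π u X,
        List.append_nil, ← length_samples]
      exact (samples_prefix (hist_prefix π u X hτn) _).length_le
    rw [plays_obs_arrivals π u X hv hd] at h1
    refine le_trans ?_ (Nat.add_le_add_right h1 _)
    rw [Finset.mul_sum, ← Finset.sum_add_distrib]
    refine Finset.sum_le_sum fun w _ => ?_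
    -- Plays before τ + 1 - d have been reported by the end of round τ; from τ + 1 + d on, a play of
    -- a would repeat a leader's play later than τ. The window between has length at most 2d.
    have hsub : (Finset.range n).filter (fun t => act π d v u X (t, w) = a) ⊆
        (Finset.range (τ + 1 - d w)).filter (fun s => act π d v u X (s, w) = a) ∪
          Finset.Ico (τ + 1 - d w) (τ + 1 + d w) := by
      intro s hs
      simp only [Finset.mem_filter, Finset.mem_range, Finset.mem_union, Finset.mem_Ico] at hs ⊢
      by_cases h : s < τ + 1 - d w
      · exact Or.inl ⟨h, hs.2⟩
      · refine Or.inr ⟨by omega, ?_⟩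
        by_contra hc
        have hle : d w ≤ s := by omega
        have := hs.2
        simp only [act, relay, hle, if_true] at this
        have := hmax _ (by omega) this
        omega
    refine (Finset.card_le_card hsub).trans ((Finset.card_union_le _ _).trans ?_)
    rw [Nat.card_Ico]
    omega
  -- If the leader never plays a, a follower can play it only by its own coin, in its first d
  -- rounds.
  · push Not at hτ
    refine le_trans ?_ (Nat.le_add_left _ _)
    rw [Finset.mul_sum]
    refine Finset.sum_le_sum fun w _ => ?_
    have hsub : (Finset.range n).filter (fun t => act π d v u X (t, w) = a) ⊆
        Finset.range (d w) := by
      intro s hs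
      simp only [Finset.mem_filter, Finset.mem_range] at hs ⊢
      by_contra hc
      have hle : d w ≤ s := by omega
      have h := hs.2
      simp only [act, relay, hle, if_true] at h
      exact hτ _ (by omega) h
    refine (Finset.card_le_card hsub).trans ?_
    rw [Finset.card_range]
    omega

/-! ### Which rewards a run depends on -/

variable {π u X}

lemma drained_congr (hd : ∀ w, w ≠ v → 0 < d w) {X' : ℕ × Fin m × Fin k → ℝ} {t : ℕ}
    (hst : leaderState π d v u X t = leaderState π d v u X' t)
    (h : ∀ c ∈ msgCells d v t, X (c.1, c.2, act π d v u X c) = X' (c.1, c.2, act π d v u X c)) :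
    drained π u X d v t = drained π u X' d v t := by
  have hmsg : messages d v u X (leaderState π d v u X t).lead t =
      messages d v u X' (leaderState π d v u X t).lead t := by
    have hM := messages_eq_obs π u X hd t
    simp only [messages, obs, msgCells, List.map_map] at hM ⊢
    refine List.map_congr_left fun w hw => ?_
    have h1 := (List.map_inj_left.1 hM) w hw
    simp only [Function.comp, Prod.mk.injEq] at h1
    have h2 := h (t - d w, w) (by
      simp only [msgCells, List.mem_map]
      exact ⟨w, hw, rfl⟩)
    simp only at h2
    simp only [h1.1, h2]
  simp only [drained, ← hst, hmsg]

/-- The leader's state depends on the rewards only through those that were received. -/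
lemma leaderState_congr (hv : d v = 0) (hd : ∀ w, w ≠ v → 0 < d w) {X' : ℕ × Fin m × Fin k → ℝ}
    {t : ℕ} (h : ∀ c ∈ arrivals d v t, X (c.1, c.2, act π d v u X c) = X' (c.1, c.2, act π d v u X c)) :
    leaderState π d v u X t = leaderState π d v u X' t := by
  induction t with
  | zero => rfl
  | succ t ih =>
    have hst := ih fun c hc => h c (by simp [arrivals, hc])
    have hD := drained_congr hd hst fun c hc => h c (by simp [arrivals, hc])
    have hX : X (t, v, leadAct π d v u X t) = X' (t, v, leadAct π d v u X t) := by
      have := h (t, v) (by simp [arrivals])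
      simpa only [act_leader _ _ _ hv] using this
    have hlead : leadAct π d v u X t = leadAct π d v u X' t := by
      rw [leadAct_eq, leadAct_eq, hD]
    have hlead' : ∀ Y, (leaderState π d v u Y (t + 1)).lead =
        Function.update (leaderState π d v u Y t).lead t (leadAct π d v u Y t) := fun Y => by
      rw [leadAct_eq]; rfl
    have hext : ∀ S S' : LeaderState k, S.lead = S'.lead → S.queue = S'.queue → S.hist = S'.hist →
        S = S' := by
      rintro ⟨_, _, _⟩ ⟨_, _, _⟩ rfl rfl rfl; rfl
    refine hext _ _ ?_ ?_ ?_
    · rw [hlead', hlead', hst, hlead]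
    · rw [queue_succ, queue_succ, hD]
    · rw [hist_succ, hist_succ, hD, ← hlead, hX]

/-- An agent at distance d lags d rounds behind, so the leader's state before round t fixes its
actions up to round t + d - 1. -/
lemma act_congr_of_leaderState {X' : ℕ × Fin m × Fin k → ℝ} {t : ℕ}
    (h : leaderState π d v u X t = leaderState π d v u X' t) {c : ℕ × Fin m}
    (hc : c.1 < t + d c.2) : act π d v u X c = act π d v u X' c := by
  simp only [act, relay]
  split_ifs with hle
  · rw [← lead_succ_of_lt π u X (t := t) (by omega), ← lead_succ_of_lt π u X' (t := t) (by omega), h]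
  · rfl

/-- The interaction depends on the rewards only through those that were received. -/
lemma act_congr (hv : d v = 0) (hd : ∀ w, w ≠ v → 0 < d w) {X' : ℕ × Fin m × Fin k → ℝ}
    (h : ∀ c : ℕ × Fin m, X (c.1, c.2, act π d v u X c) = X' (c.1, c.2, act π d v u X c)) :
    act π d v u X = act π d v u X' :=
  funext fun c => act_congr_of_leaderState (t := c.1 + 1)
    (leaderState_congr hv hd fun c _ => h c) (by omega)

/-- The rewards at `c` do not affect the actions at `c` and at the places that are known to the leader
before `c`. -/
lemma act_congr_off (hv : d v = 0) (hd : ∀ w, w ≠ v → 0 < d w) {X' : ℕ × Fin m × Fin k → ℝ}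
    {c c' : ℕ × Fin m} (h : ∀ b ≠ c, ∀ a, X (b.1, b.2, a) = X' (b.1, b.2, a))
    (hle : c'.1 + d c'.2 ≤ c.1 + d c.2)
    (hor : c'.2 ≠ v ∨ c'.1 + d c'.2 < c.1 + d c.2 ∨ c.2 = v) :
    act π d v u X c' = act π d v u X' c' := by
  have hst : leaderState π d v u X (c.1 + d c.2) = leaderState π d v u X' (c.1 + d c.2) := by
    refine leaderState_congr hv hd fun b hb => h b ?_ _
    rintro rfl
    simp [mem_arrivals hv] at hb
  by_cases hlt : c'.1 < c.1 + d c.2 + d c'.2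
  · exact act_congr_of_leaderState hst hlt
  -- What remains is c' = c, a place of the leader itself: the action is chosen from the old state
  -- and the followers' messages, before the reward at c is received.
  · have hc' : c'.2 = v := by
      by_contra hne
      have := hd _ hne
      omega
    have h0 : d c'.2 = 0 := hc' ▸ hv
    have hcv : c.2 = v := by
      rcases hor with h | h | h
      · exact absurd hc' h
      · omega
      · exact h
    have hc1 : c'.1 = c.1 + d c.2 := by omega
    have hcc : c' = (c'.1, v) := Prod.ext rfl hc'
    rw [hcc, act_leader _ _ _ hv, act_leader _ _ _ hv, leadAct_eq, leadAct_eq, hc1]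
    rw [drained_congr hd hst fun b hb => h b ?_ _]
    rintro rfl
    exact (mem_msgCells.1 hb).1 hcv

end run

end Quack

/-! ### Measurability of the run -/

section countable

variable {Ω α β γ : Type*} [MeasurableSpace Ω]

/-- The source of measurability for the run: its combinatorial data, lists of actions and places,
take countably many values and carry the discrete σ-algebra. Once they are fixed, only measurable
functions of the rewards remain. -/
lemma measurable_of_countable_index [Countable α] [MeasurableSpace β] {S : Ω → α}
    (hS : Measurable[_, ⊤] S) {F : α → Ω → β} (hF : ∀ a, Measurable (F a)) :
    Measurable fun ω => F (S ω) ω := by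
  intro t ht
  have h : (fun ω => F (S ω) ω) ⁻¹' t = ⋃ a, S ⁻¹' {a} ∩ F a ⁻¹' t := by
    ext ω; simp
  rw [h]
  exact MeasurableSet.iUnion fun a => (hS trivial).inter (hF a ht)

lemma measurable_top_map₂ [Countable α] {S : Ω → α} {T : Ω → β} (hS : Measurable[_, ⊤] S)
    (hT : Measurable[_, ⊤] T) (f : α → β → γ) : Measurable[_, ⊤] fun ω => f (S ω) (T ω) :=
  letI : MeasurableSpace β := ⊤
  letI : MeasurableSpace γ := ⊤
  measurable_of_countable_index hS (F := fun a ω => f a (T ω)) fun _ => measurable_from_top.comp hT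

lemma measurable_top_list_map {δ : Type*} [Countable β] {f : δ → Ω → β} {g : δ → β → γ} (L : List δ)
    (hf : ∀ c ∈ L, Measurable[_, ⊤] (f c)) :
    Measurable[_, ⊤] fun ω => L.map fun c => g c (f c ω) := by
  induction L with
  | nil => exact @measurable_const _ _ ⊤ _ _
  | cons c L ih =>
    exact measurable_top_map₂ (hf c (by simp)) (ih fun c' h => hf c' (by simp [h]))
      fun b l => g c b :: l

end countable

namespace Quack

/-- The action-reward pairs named by a list of actions and places in the reward table `X`. -/
def evalHist {ι : Type*} {k : ℕ} (X : ι → ℝ) (l : List (Fin k × ι)) : List (Fin k × ℝ) :=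
  l.map fun p => (p.1, X p.2)

/-- The queues and the history named by lists of places in the reward table `X`. -/
def evalState {ι : Type*} {k : ℕ} (X : ι → ℝ) (q : (Fin k → List ι) × List (Fin k × ι)) :
    (Fin k → List ℝ) × List (Fin k × ℝ) :=
  (fun a => (q.1 a).map X, evalHist X q.2)

/-- Measurability of the decisions of a bandit algorithm in the rewards. -/
def MeasurablePolicy {k : ℕ} (ι : Type*) (π : Policy k) : Prop :=
  ∀ l : List (Fin k × ι), Measurable fun X : ι → ℝ => π (evalHist X l)

lemma drain_of_nil {k : ℕ} {π : Policy k} {Q : Fin k → List ℝ} {H : List (Fin k × ℝ)}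
    (h : Q (π H) = []) : drain π Q H = (Q, H) := by
  rw [drain]
  split
  · rfl
  · rename_i h'; rw [h] at h'; cases h'

lemma drain_of_cons {k : ℕ} {π : Policy k} {Q : Fin k → List ℝ} {H : List (Fin k × ℝ)} {x : ℝ}
    {q : List ℝ} (h : Q (π H) = x :: q) :
    drain π Q H = drain π (Function.update Q (π H) q) (H ++ [(π H, x)]) := by
  rw [drain]
  split
  · rename_i h'; rw [h] at h'; cases h'
  · rename_i h'; rw [h] at h'; cases h'; rfl

section measurability

variable {Ω : Type*} [MeasurableSpace Ω] {m k : ℕ}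

/-- The loop is run symbolically, on places in the table instead of rewards. It branches only on the
finitely many decisions of π, and the total queue length decreases. -/
lemma exists_measurable_drain {ι : Type*} [Countable ι] {π : Policy k} (hπ : MeasurablePolicy ι π)
    {X : Ω → ι → ℝ} (hX : Measurable X) (q : (Fin k → List ι) × List (Fin k × ι)) :
    ∃ q' : Ω → (Fin k → List ι) × List (Fin k × ι), Measurable[_, ⊤] q' ∧
      ∀ ω, drain π (evalState (X ω) q).1 (evalState (X ω) q).2 = evalState (X ω) (q' ω) := by
  obtain ⟨n, hn⟩ : ∃ n, ∑ a, (q.1 a).length = n := ⟨_, rfl⟩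
  induction n using Nat.strong_induction_on generalizing q with
  | _ n ih =>
    have key : ∀ a : Fin k, ∃ q' : Ω → (Fin k → List ι) × List (Fin k × ι), Measurable[_, ⊤] q' ∧
        ∀ ω, π (evalHist (X ω) q.2) = a →
          drain π (evalState (X ω) q).1 (evalState (X ω) q).2 = evalState (X ω) (q' ω) := by
      intro a
      rcases hqa : q.1 a with _ | ⟨x, r⟩
      · refine ⟨fun _ => q, @measurable_const _ _ ⊤ _ _, fun ω ha => ?_⟩
        rw [drain_of_nil]
        simp [evalState, ha, hqa]
      · obtain ⟨q', hq', h'⟩ := ih _ (hn ▸ Finset.sum_lt_sum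
          (f := fun b => (Function.update q.1 a r b).length) (fun b _ => by
            by_cases hb : b = a
            · subst hb; simp [hqa]
            · simp [Function.update_of_ne hb]) ⟨a, Finset.mem_univ _, by simp [hqa]⟩)
          (Function.update q.1 a r, q.2 ++ [(a, x)]) rfl
        refine ⟨q', hq', fun ω ha => ?_⟩
        rw [← h', drain_of_cons (x := X ω x) (q := r.map (X ω))]
        · have h1 : (evalState (X ω) q).2 = evalHist (X ω) q.2 := rfl
          rw [h1, ha]
          congr 1
          · funext b
            by_cases hb : b = a
            · subst hb; simp [evalState]
            · simp [evalState, Function.update_of_ne hb]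
          · simp [evalState, evalHist]
        · simp [evalState, ha, hqa]
    choose q' hq' h' using key
    exact ⟨fun ω => q' (π (evalHist (X ω) q.2)) ω,
      @measurable_of_countable_index _ _ _ _ _ ⊤ _ ((hπ q.2).comp hX) q' hq', fun ω => h' _ ω rfl⟩

variable [NeZero k] {π : Policy k} {d : Fin m → ℕ} {v : Fin m} {u : Ω → ℕ × Fin m → Fin k}
  {X : Ω → ℕ × Fin m × Fin k → ℝ}

/-- Queues and history are evaluations of symbolic lists. The past actions of the leader are carried
along in the induction because the messages depend on them. -/
lemma measurable_leader_aux (hd : ∀ w, w ≠ v → 0 < d w)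
    (hπ : MeasurablePolicy (ℕ × Fin m × Fin k) π) (hu : Measurable u) (hX : Measurable X) (t : ℕ) :
    (∃ q : Ω → (Fin k → List (ℕ × Fin m × Fin k)) × List (Fin k × (ℕ × Fin m × Fin k)),
      Measurable[_, ⊤] q ∧ ∀ ω, ((leaderState π d v (u ω) (X ω) t).queue,
        (leaderState π d v (u ω) (X ω) t).hist) = evalState (X ω) (q ω)) ∧
    ∀ s < t, Measurable fun ω => leadAct π d v (u ω) (X ω) s := by
  induction t with
  | zero => exact ⟨⟨fun _ => (fun _ => [], []), @measurable_const _ _ ⊤ _ _, fun ω => by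
      simp [leaderState, evalState, evalHist]⟩, by simp⟩
  | succ t ih =>
    obtain ⟨⟨q, hq, hqe⟩, hlead⟩ := ih
    have hact : ∀ c ∈ msgCells d v t, Measurable fun ω => act π d v (u ω) (X ω) c := by
      intro c hc
      obtain ⟨hcv, hct⟩ := mem_msgCells.1 hc
      have := hd _ hcv
      simp only [act, relay]
      split_ifs
      · exact hlead _ (by omega)
      · exact (measurable_pi_apply c).comp hu
    let M : Ω → List (Fin k × (ℕ × Fin m × Fin k)) := fun ω =>
      (msgCells d v t).map fun c => (act π d v (u ω) (X ω) c, (c.1, c.2, act π d v (u ω) (X ω) c))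
    have hM : Measurable[_, ⊤] M :=
      measurable_top_list_map (f := fun c ω => act π d v (u ω) (X ω) c)
        (g := fun c a => (a, (c.1, c.2, a))) _ hact
    let q₁ : Ω → (Fin k → List (ℕ × Fin m × Fin k)) × List (Fin k × (ℕ × Fin m × Fin k)) := fun ω =>
      (fun a => (q ω).1 a ++ ((M ω).filter fun p => p.1 = a).map Prod.snd, (q ω).2)
    have hq₁ : Measurable[_, ⊤] q₁ := measurable_top_map₂ hq hM fun q M =>
      (fun a => q.1 a ++ (M.filter fun p => p.1 = a).map Prod.snd, q.2)
    have hdr : ∀ ω, drained π (u ω) (X ω) d v t =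
        drain π (evalState (X ω) (q₁ ω)).1 (evalState (X ω) (q₁ ω)).2 := by
      intro ω
      have h1 := congrArg Prod.fst (hqe ω)
      have h2 := congrArg Prod.snd (hqe ω)
      simp only at h1 h2
      rw [drained, h1, h2, messages_eq_obs π _ _ hd]
      congr 1
      funext a
      simp [evalState, q₁, M, samples, obs, List.filter_map, Function.comp_def]
    choose dr hdrm hdre using exists_measurable_drain (Ω := Ω) hπ hX
    have hq₂ : Measurable[_, ⊤] fun ω => dr (q₁ ω) ω :=
      @measurable_of_countable_index _ _ _ _ _ ⊤ _ hq₁ dr hdrm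
    have hq₂e : ∀ ω, drained π (u ω) (X ω) d v t = evalState (X ω) (dr (q₁ ω) ω) := fun ω => by
      rw [hdr, hdre]
    have hl : Measurable fun ω => leadAct π d v (u ω) (X ω) t := by
      have : (fun ω => leadAct π d v (u ω) (X ω) t) =
          fun ω => π (evalHist (X ω) (dr (q₁ ω) ω).2) := by
        funext ω; rw [leadAct_eq, hq₂e]; rfl
      rw [this]
      exact measurable_of_countable_index hq₂ (F := fun q ω => π (evalHist (X ω) q.2))
        fun q => (hπ q.2).comp hX
    refine ⟨⟨_, measurable_top_map₂ hq₂ (T := fun ω => leadAct π d v (u ω) (X ω) t) hl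
      fun q a => (q.1, q.2 ++ [(a, (t, v, a))]), fun ω => ?_⟩, fun s hs => ?_⟩
    · rw [queue_succ, hist_succ, hq₂e]
      simp [evalState, evalHist]
    · rcases Nat.lt_succ_iff_lt_or_eq.1 hs with h | rfl
      · exact hlead s h
      · exact hl

lemma measurable_act (hd : ∀ w, w ≠ v → 0 < d w) (hπ : MeasurablePolicy (ℕ × Fin m × Fin k) π)
    (hu : Measurable u) (hX : Measurable X) (c : ℕ × Fin m) :
    Measurable fun ω => act π d v (u ω) (X ω) c := by
  simp only [act, relay]
  split_ifs
  · exact (measurable_leader_aux hd hπ hu hX _).2 _ (Nat.lt_succ_self _)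
  · exact (measurable_pi_apply c).comp hu

end measurability

end Quack

namespace LDP

/-- For fixed places the play counts are constants, so forced exploration does not depend on the
rewards; only the choice of the first maximiser does. -/
lemma measurablePolicy_ldpUcbL {k : ℕ} [NeZero k] (ι : Type*) (ε : ℝ) :
    Quack.MeasurablePolicy ι (ldpUcbL (k := k) ε) := by
  intro l
  have hlen : ∀ X : ι → ℝ, (Quack.evalHist X l).length = l.length := fun X => by
    simp [Quack.evalHist]
  have hplays : ∀ (X : ι → ℝ) (a : Fin k), plays (Quack.evalHist X l) a =
      l.countP (fun p => p.1 = a) := fun X a => by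
    simp [plays, Quack.evalHist, List.countP_map, Function.comp_def]
  have hsum : ∀ a : Fin k, Measurable fun X : ι → ℝ => (Quack.samples (Quack.evalHist X l) a).sum := by
    intro a
    clear hlen hplays
    induction l using List.reverseRecOn with
    | nil => simp [Quack.evalHist]
    | append_singleton l p ih =>
      have : ∀ X : ι → ℝ, Quack.evalHist X (l ++ [p]) = Quack.evalHist X l ++ [(p.1, X p.2)] :=
        fun X => by simp [Quack.evalHist]
      simp only [this, Quack.samples_append, List.sum_append, Quack.samples_singleton]
      refine ih.add ?_
      split_ifs
      · simpa using measurable_pi_apply p.2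
      · simp
  have hucb : ∀ a, Measurable fun X : ι → ℝ => ucb ε (Quack.evalHist X l) a := by
    intro a
    simp only [ucb, empMean, hplays, hlen]
    exact (((hsum a).div_const _).add_const _).add_const _
  by_cases h : (Finset.univ.filter fun a : Fin k =>
      (l.countP (fun p => p.1 = a) : ℝ) ≤ 4 * Real.log (l.length + 1)).Nonempty
  · have : (fun X : ι → ℝ => ldpUcbL (k := k) ε (Quack.evalHist X l)) = fun _ => Finset.min' _ h := by
      funext X
      simp only [ldpUcbL, underSampled, hplays, hlen, h, dite_true]
    rw [this]
    exact measurable_const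
  · have heq : ∀ X : ι → ℝ, ldpUcbL (k := k) ε (Quack.evalHist X l) =
        (maximisers ε (Quack.evalHist X l)).min' (maximisers_nonempty ε _) := fun X => by
      simp only [ldpUcbL, underSampled, hplays, hlen, h, dite_false]
    have hmem : ∀ a, MeasurableSet {X : ι → ℝ | a ∈ maximisers ε (Quack.evalHist X l)} := by
      intro a
      simp only [maximisers, Finset.mem_filter, Finset.mem_univ, true_and, Set.ofPred_forall]
      exact MeasurableSet.iInter fun b => measurableSet_le (hucb b) (hucb a)
    refine measurable_to_countable' fun a => ?_
    have : (fun X : ι → ℝ => ldpUcbL (k := k) ε (Quack.evalHist X l)) ⁻¹' {a} =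
        {X | a ∈ maximisers ε (Quack.evalHist X l)} ∩
          ⋂ b, {X | b ∈ maximisers ε (Quack.evalHist X l) → a ≤ b} := by
      ext X
      simp only [Set.mem_preimage, Set.mem_singleton_iff, heq, Set.mem_inter_iff, Set.mem_ofPred_eq,
        Set.mem_iInter]
      constructor
      · rintro rfl
        exact ⟨Finset.min'_mem _ _, fun b hb => Finset.min'_le _ _ hb⟩
      · rintro ⟨h1, h2⟩
        exact le_antisymm (Finset.min'_le _ _ h1) (Finset.le_min' _ _ _ h2)
    rw [this]
    refine (hmem a).inter (MeasurableSet.iInter fun b => ?_)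
    by_cases hab : a ≤ b
    · simp [hab]
    · simp only [hab, imp_false]
      exact (hmem b).compl

end LDP

/-! ### Resampling one coordinate of a product measure -/

section resampling

variable {ι : Type*} [DecidableEq ι] {μ : ι → Measure ℝ} [∀ i, IsProbabilityMeasure (μ i)]

/-- Replacing one coordinate of an independent family by an independent copy does not change the law. -/
lemma map_update_infinitePi (i : ι) :
    ((Measure.infinitePi μ).prod (μ i)).map (fun p => Function.update p.1 i p.2) =
      Measure.infinitePi μ := by
  refine Measure.eq_infinitePi μ fun s t ht => ?_
  rw [Measure.map_apply measurable_update'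
    (MeasurableSet.pi s.countable_toSet fun j _ => ht j)]
  have h1 : (fun p : (ι → ℝ) × ℝ => Function.update p.1 i p.2) ⁻¹' (Set.pi s t) =
      Set.pi (s.erase i : Finset ι) t ×ˢ {y | i ∈ s → y ∈ t i} := by
    ext p
    simp only [Set.mem_preimage, Set.mem_pi, Set.mem_prod, Set.mem_ofPred_eq, Finset.coe_erase,
      Set.mem_sdiff, Set.mem_singleton_iff, SetLike.mem_coe]
    constructor
    · intro h
      exact ⟨fun j hj => by simpa [Function.update_of_ne hj.2] using h j hj.1,
        fun hi => by simpa using h i hi⟩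
    · rintro ⟨h1, h2⟩ j hj
      by_cases hji : j = i
      · subst hji; simpa using h2 hj
      · simpa [Function.update_of_ne hji] using h1 j ⟨hj, hji⟩
  rw [h1, Measure.prod_prod, Measure.infinitePi_pi _ fun j _ => ht j]
  by_cases hi : i ∈ s
  · simp only [hi, true_imp_iff]
    exact Finset.prod_erase_mul s (fun j => μ j (t j)) hi
  · simp [hi]

/-- Isolates one coordinate with the others frozen, as needed both for the privacy shift and for the
supermartingale step. -/
lemma lintegral_infinitePi_eq_lintegral_update (i : ι) {f : (ι → ℝ) → ENNReal} (hf : Measurable f) :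
    ∫⁻ z, f z ∂(Measure.infinitePi μ) =
      ∫⁻ z, ∫⁻ y, f (Function.update z i y) ∂(μ i) ∂(Measure.infinitePi μ) := by
  conv_lhs => rw [← map_update_infinitePi (μ := μ) i]
  rw [lintegral_map hf measurable_update', lintegral_prod]
  exact (hf.comp measurable_update').aemeasurable

end resampling

lemma measure_eq_sum_inter_preimage {Ω : Type*} [MeasurableSpace Ω] (μ : Measure Ω) {k : ℕ}
    {f : Ω → Fin k} (hf : Measurable f) {B : Set Ω} (hB : MeasurableSet B) :
    μ B = ∑ a, μ (B ∩ f ⁻¹' {a}) := by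
  rw [← tsum_fintype (L := .unconditional _), ← measure_iUnion]
  · congr 1
    ext ω; simp
  · intro a b hab
    exact Set.disjoint_left.2 fun ω h1 h2 => hab (h1.2.symm.trans h2.2)
  · exact fun a => hB.inter (hf (measurableSet_singleton a))

/-! ### The Laplace mechanism -/

namespace LDP

lemma measurable_laplace_density (ε : ℝ) :
    Measurable fun x : ℝ => ENNReal.ofReal (ε / 2 * Real.exp (-(ε * |x|))) := by
  fun_prop

lemma lintegral_laplace (ε : ℝ) {f : ℝ → ENNReal} (hf : Measurable f) :
    ∫⁻ y, f y ∂(laplace ε) = ∫⁻ y, ENNReal.ofReal (ε / 2 * Real.exp (-(ε * |y|))) * f y := by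
  rw [laplace, lintegral_withDensity_eq_lintegral_mul _ (measurable_laplace_density ε) hf]
  rfl

/-- The moment generating function of the Laplace distribution. -/
lemma lintegral_exp_laplace {ε l : ℝ} (h : |l| < ε) :
    ∫⁻ y, ENNReal.ofReal (Real.exp (l * y)) ∂(laplace ε) =
      ENNReal.ofReal (ε ^ 2 / (ε ^ 2 - l ^ 2)) := by
  obtain ⟨h1, h2⟩ := abs_lt.1 h
  have hε : 0 < ε := (abs_nonneg l).trans_lt h
  -- On each half-line the exponent is linear, with slope ε + l on the left and l - ε on the right;
  -- |l| < ε makes both integrals converge.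
  have key : ∀ (s : Set ℝ) (c : ℝ), MeasurableSet s → IntegrableOn (fun y => Real.exp (c * y)) s →
      (∀ y ∈ s, -(ε * |y|) + l * y = c * y) →
      ∫⁻ y in s, ENNReal.ofReal (ε / 2 * Real.exp (-(ε * |y|))) * ENNReal.ofReal (Real.exp (l * y)) =
        ENNReal.ofReal (ε / 2 * ∫ y in s, Real.exp (c * y)) := by
    intro s c hs hint hc
    rw [← integral_const_mul, ofReal_integral_eq_lintegral_ofReal (hint.const_mul _)
      (ae_of_all _ fun y => by positivity)]
    refine setLIntegral_congr_fun hs fun y hy => ?_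
    rw [← ENNReal.ofReal_mul (by positivity), mul_assoc, ← Real.exp_add, hc y hy]
  rw [lintegral_laplace ε (by fun_prop), ← lintegral_add_compl _ (measurableSet_Iic (a := (0 : ℝ))),
    Set.compl_Iic, key _ (ε + l) measurableSet_Iic (integrableOn_exp_mul_Iic (by linarith) 0),
    key _ (l - ε) measurableSet_Ioi (integrableOn_exp_mul_Ioi (by linarith) 0),
    integral_exp_mul_Iic (by linarith), integral_exp_mul_Ioi (by linarith), ← ENNReal.ofReal_add]
  · congr 1
    have : ε ^ 2 - l ^ 2 ≠ 0 := by nlinarith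
    have : ε + l ≠ 0 := by linarith
    have : l - ε ≠ 0 := by linarith
    simp only [mul_zero, Real.exp_zero]
    field_simp
    ring
  · have : 0 < ε + l := by linarith
    simp only [mul_zero, Real.exp_zero]
    positivity
  · have : 0 < ε - l := by linarith
    simp only [mul_zero, Real.exp_zero]
    rw [← neg_sub ε l, neg_div_neg_eq]
    positivity
  · intro y hy
    rw [abs_of_pos hy]; ring
  · intro y hy
    rw [abs_of_nonpos hy]; ring

lemma isProbabilityMeasure_laplace {ε : ℝ} (hε : 0 < ε) : IsProbabilityMeasure (laplace ε) := by
  have h := lintegral_exp_laplace (ε := ε) (l := 0) (by simpa using hε)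
  have hne : ε ^ 2 ≠ 0 := by positivity
  constructor
  simpa [hne] using h

/-- Shifting the Laplace distribution by at most `1` costs at most a factor `e^ε`. -/
lemma lintegral_laplace_add_le {ε δ : ℝ} (hε : 0 < ε) (hδ : |δ| ≤ 1) {f : ℝ → ENNReal}
    (hf : Measurable f) :
    ∫⁻ y, f (y + δ) ∂(laplace ε) ≤ ENNReal.ofReal (Real.exp ε) * ∫⁻ y, f y ∂(laplace ε) := by
  -- Translation invariance moves the shift from f to the density, where the triangle inequality
  -- bounds the change of exponent by ε|δ|.
  rw [lintegral_laplace ε (f := fun y => f (y + δ)) (hf.comp (measurable_add_const δ)),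
    lintegral_laplace ε hf, ← lintegral_const_mul' _ _ ENNReal.ofReal_ne_top,
    ← lintegral_add_right_eq_self _ (-δ)]
  refine lintegral_mono fun y => ?_
  simp only [neg_add_cancel_right]
  rw [← mul_assoc]
  gcongr
  rw [← ENNReal.ofReal_mul (Real.exp_pos _).le]
  apply ENNReal.ofReal_le_ofReal
  rw [mul_left_comm, ← Real.exp_add]
  gcongr
  have h1 : |y| ≤ |y + -δ| + |δ| := by
    have := abs_add_le (y + -δ) δ
    simpa using this
  nlinarith

lemma isLDP_laplaceMechanism {ε : ℝ} (hε : 0 < ε) :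
    IsLDP ε (Set.Icc (0 : ℝ) 1) (laplaceMechanism ε) := by
  intro x hx x' hx'
  have := isProbabilityMeasure_laplace hε
  have hm : ∀ x : ℝ, Measurable fun z : ℝ => x + z := fun x => measurable_const_add x
  refine ⟨Measure.isProbabilityMeasure_map (hm x).aemeasurable,
    Measure.isProbabilityMeasure_map (hm x').aemeasurable, fun E hE => ?_⟩
  have h : ∀ x, laplaceMechanism ε x E = ∫⁻ y, E.indicator 1 (x + y) ∂(laplace ε) := fun x => by
    rw [laplaceMechanism, Measure.map_apply (hm x) hE, ← lintegral_indicator_one (hm x hE)]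
    rfl
  rw [h, h]
  have h1 := lintegral_laplace_add_le hε (δ := x - x') (f := fun y => E.indicator 1 (x' + y))
    (by rw [abs_le]; constructor <;> linarith [hx.1, hx.2, hx'.1, hx'.2])
    ((measurable_one.indicator hE).comp (hm x'))
  convert h1 using 4
  ring

end LDP

/-! ### Privacy of the interaction -/

namespace Quack

variable {m k : ℕ} [NeZero k] {π : Policy k} {G : SimpleGraph (Fin m)} {v : Fin m}

lemma action_eq_act (u : ℕ × Fin m → Fin k) (X : ℕ × Fin m × Fin k → ℝ) (t : ℕ) (w : Fin m) :
    action π G v u X t w = act π (G.dist v) v u X (t, w) := by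
  simp only [action, act, relay]
  split_ifs
  · exact lead_succ_of_lt π u X (by omega)
  · rfl

lemma transcript_eq (u : ℕ × Fin m → Fin k) (X : ℕ × Fin m × Fin k → ℝ) :
    transcript π G v u X = fun c => (act π (G.dist v) v u X c,
      X (c.1, c.2, act π (G.dist v) v u X c)) := by
  funext c
  simp only [transcript, action_eq_act]

lemma dist_pos_of_ne (hG : G.Connected) (w : Fin m) (hw : w ≠ v) : 0 < G.dist v w :=
  hG.pos_dist_of_ne hw.symm

lemma measurable_reward_act {Ω : Type*} [MeasurableSpace Ω] {u : Ω → ℕ × Fin m → Fin k}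
    {X : Ω → ℕ × Fin m × Fin k → ℝ} {d : Fin m → ℕ} (hd : ∀ w, w ≠ v → 0 < d w)
    (hπ : MeasurablePolicy (ℕ × Fin m × Fin k) π) (hu : Measurable u) (hX : Measurable X)
    (c : ℕ × Fin m) : Measurable fun ω => X ω (c.1, c.2, act π d v (u ω) (X ω) c) :=
  measurable_of_countable_index (S := fun ω => act π d v (u ω) (X ω) c)
    (measurable_act hd hπ hu hX c) (F := fun a ω => X ω (c.1, c.2, a))
    fun _ => (measurable_pi_apply _).comp hX

end Quack

namespace LDP

variable {m k : ℕ} [NeZero k]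

lemma isProbabilityMeasure_coinLaw : IsProbabilityMeasure (coinLaw m k) := by
  unfold coinLaw; infer_instance

lemma isProbabilityMeasure_noiseLaw {ε : ℝ} (hε : 0 < ε) : IsProbabilityMeasure (noiseLaw m ε) := by
  have := isProbabilityMeasure_laplace hε
  unfold noiseLaw; infer_instance

lemma measurable_privatise {m k : ℕ} :
    Measurable fun p : (ℕ × Fin m × Fin k → ℝ) × (ℕ × Fin m → ℝ) => privatise p.1 p.2 := by
  unfold privatise; fun_prop

/-- Running QuACK on privatised rewards is `ε`-LDP, whatever the bandit algorithm. -/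
lemma isInteractiveLDP_transcriptLaw {π : Quack.Policy k}
    (hπ : Quack.MeasurablePolicy (ℕ × Fin m × Fin k) π) {G : SimpleGraph (Fin m)} (v : Fin m)
    {ε : ℝ} (hG : G.Connected) (hε : 0 < ε) :
    IsInteractiveLDP ε (transcriptLaw (k := k) π G v ε) := by
  intro x x' hx hx' p hp
  have hprob := isProbabilityMeasure_laplace hε
  have hC := isProbabilityMeasure_coinLaw (m := m) (k := k)
  have hN := isProbabilityMeasure_noiseLaw (m := m) hε
  have hv : G.dist v v = 0 := SimpleGraph.dist_self
  have hd := Quack.dist_pos_of_ne (v := v) hG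
  let Y : (ℕ × Fin m × Fin k → ℝ) → (ℕ × Fin m → Fin k) × (ℕ × Fin m → ℝ) →
    ℕ × Fin m × Fin k → ℝ := fun x ω => privatise x ω.2
  have hY : ∀ x, Measurable (Y x) := fun x =>
    measurable_privatise.comp (measurable_const.prodMk measurable_snd)
  have hact : ∀ x c, Measurable fun ω => Quack.act π (G.dist v) v ω.1 (Y x ω) c := fun x c =>
    Quack.measurable_act hd hπ measurable_fst (hY x) c
  have hF : ∀ x, Measurable fun ω : (ℕ × Fin m → Fin k) × (ℕ × Fin m → ℝ) =>
      Quack.transcript π G v ω.1 (Y x ω) := by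
    intro x
    simp only [Quack.transcript_eq]
    exact measurable_pi_lambda _ fun c => (hact x c).prodMk
      (Quack.measurable_reward_act hd hπ measurable_fst (hY x) c)
  refine ⟨Measure.isProbabilityMeasure_map (hF x).aemeasurable,
    Measure.isProbabilityMeasure_map (hF x').aemeasurable, fun E hE => ?_⟩
  -- The shift of the noise depends on the action played at p, so the event is split by that action.
  rw [transcriptLaw, transcriptLaw, Measure.map_apply (hF x) hE, Measure.map_apply (hF x') hE,
    measure_eq_sum_inter_preimage _ (hact x p) (hF x hE),
    measure_eq_sum_inter_preimage _ (hact x' p) (hF x' hE), Finset.mul_sum]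
  refine Finset.sum_le_sum fun a _ => ?_
  set B := fun x => (fun ω : (ℕ × Fin m → Fin k) × (ℕ × Fin m → ℝ) =>
    Quack.transcript π G v ω.1 (Y x ω)) ⁻¹' E ∩
      (fun ω => Quack.act π (G.dist v) v ω.1 (Y x ω) p) ⁻¹' {a} with hBdef
  have hB : ∀ x, MeasurableSet (B x) := fun x =>
    (hF x hE).inter (hact x p (measurableSet_singleton a))
  have hind : ∀ x, Measurable ((B x).indicator (1 : (ℕ × Fin m → Fin k) × (ℕ × Fin m → ℝ) → ENNReal)) := fun x =>
    measurable_one.indicator (hB x)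
  have hexp : ∀ x, ((coinLaw m k).prod (noiseLaw m ε)) (B x) = ∫⁻ u, ∫⁻ z, ∫⁻ y,
      (B x).indicator 1 (u, Function.update z p y) ∂(laplace ε) ∂(noiseLaw m ε) ∂(coinLaw m k) := by
    intro x
    rw [← lintegral_indicator_one (hB x), lintegral_prod _ (hind x).aemeasurable]
    refine lintegral_congr fun u => ?_
    exact lintegral_infinitePi_eq_lintegral_update (μ := fun _ => laplace ε) p
      ((hind x).comp measurable_prodMk_left)
  change ((coinLaw m k).prod (noiseLaw m ε)) (B x) ≤
    _ * ((coinLaw m k).prod (noiseLaw m ε)) (B x')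
  rw [hexp, hexp, ← lintegral_const_mul' _ _ ENNReal.ofReal_ne_top]
  refine lintegral_mono fun u => ?_
  rw [← lintegral_const_mul' _ _ ENNReal.ofReal_ne_top]
  refine lintegral_mono fun z => ?_
  set δ := x (p.1, p.2, a) - x' (p.1, p.2, a) with hδ
  have h1 := hx (p.1, p.2, a)
  have h2 := hx' (p.1, p.2, a)
  refine le_trans ?_ (lintegral_laplace_add_le hε (δ := δ)
    (f := fun y => (B x').indicator 1 (u, Function.update z p y))
    (by rw [abs_le]; constructor <;> linarith [h1.1, h1.2, h2.1, h2.2])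
    ((hind x').comp (measurable_prodMk_left.comp (measurable_update z))))
  refine lintegral_mono fun y => ?_
  by_cases hmem : (u, Function.update z p y) ∈ B x
  · have hmem' : (u, Function.update z p (y + δ)) ∈ B x' := by
      simp only [hBdef, Set.mem_inter_iff, Set.mem_preimage, Set.mem_singleton_iff,
        Quack.transcript_eq, Y] at hmem ⊢
      -- The shifted tables may still differ at p for actions other than a, but those entries are
      -- never read.
      have hagree : ∀ c : ℕ × Fin m,
          privatise x (Function.update z p y) (c.1, c.2, Quack.act π (G.dist v) v u
            (privatise x (Function.update z p y)) c) =
          privatise x' (Function.update z p (y + δ)) (c.1, c.2, Quack.act π (G.dist v) v u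
            (privatise x (Function.update z p y)) c) := by
        intro c
        by_cases hc : c = p
        · subst hc
          rw [hmem.2]
          simp only [privatise, Prod.mk.eta, Function.update_self, hδ]
          ring
        · simp only [privatise, Prod.mk.eta, Function.update_of_ne hc]
          rw [hp _ hc]
      have hacteq := Quack.act_congr hv hd hagree
      rw [← hacteq]
      refine ⟨?_, hmem.2⟩
      convert hmem.1 using 3
      exact (hagree _).symm
    simp [hmem, hmem']
  · simp [hmem]

end LDP

/-! ### The exponential supermartingale -/

namespace Quack

/-- Product of the weights `g` of the first `N` rewards of `b`. -/
noncomputable def weight {k : ℕ} (g : ℝ → ENNReal) (b : Fin k) (N : ℕ) (H : List (Fin k × ℝ)) : ENNReal :=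
  (((samples H b).take N).map g).prod

lemma weight_append_singleton {k : ℕ} (g : ℝ → ENNReal) (b : Fin k) (N : ℕ)
    (H : List (Fin k × ℝ)) (p : Fin k × ℝ) :
    weight g b N (H ++ [p]) =
      weight g b N H * if p.1 = b ∧ LDP.plays H b < N then g p.2 else 1 := by
  rw [weight, weight, samples_append, List.take_append, samples_singleton, length_samples]
  by_cases h : p.1 = b
  · by_cases h' : LDP.plays H b < N
    · have : 0 < N - LDP.plays H b := by omega
      obtain ⟨j, hj⟩ := Nat.exists_eq_succ_of_ne_zero this.ne'
      simp [h, h', hj]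
    · simp [h, h', show N - LDP.plays H b = 0 by omega]
  · simp [h]

end Quack

namespace LDP

variable {m k : ℕ} [NeZero k] {P : Fin k → Measure ℝ} {ε : ℝ}

lemma isProbabilityMeasure_rewardLaw {m k : ℕ} {P : Fin k → Measure ℝ} [∀ a, IsProbabilityMeasure (P a)] :
    IsProbabilityMeasure (rewardLaw m P) := by
  unfold rewardLaw; infer_instance

/-- The privatised reward of `b` at `c` is independent of everything that is not affected by the
reward of `b` and the noise at `c`. -/
lemma lintegral_law_mul [∀ a, IsProbabilityMeasure (P a)] (hε : 0 < ε) (c : ℕ × Fin m) (b : Fin k)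
    {F : (ℕ × Fin m × Fin k → ℝ) × (ℕ × Fin m → Fin k) × (ℕ × Fin m → ℝ) → ENNReal}
    (hF : Measurable F)
    (hinv : ∀ r u z x y, F (Function.update r (c.1, c.2, b) x, u, Function.update z c y) = F (r, u, z))
    {g : ℝ → ENNReal} (hg : Measurable g) :
    ∫⁻ ω, F ω * g (privatise ω.1 ω.2.2 (c.1, c.2, b)) ∂(law m P ε) =
      (∫⁻ ω, F ω ∂(law m P ε)) * ∫⁻ x, ∫⁻ y, g (x + y) ∂(laplace ε) ∂(P b) := by
  have hprob := isProbabilityMeasure_laplace hε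
  have hC := isProbabilityMeasure_coinLaw (m := m) (k := k)
  have hN := isProbabilityMeasure_noiseLaw (m := m) hε
  have hR := isProbabilityMeasure_rewardLaw (m := m) (P := P)
  have hgm : Measurable fun p : ℝ × ℝ => g (p.1 + p.2) := hg.comp measurable_add
  -- Both the raw reward of b at c and the noise at c are replaced by fresh copies. By `hinv`, F
  -- sees neither, so the integral factorises.
  have hup : ∀ f : (ℕ × Fin m × Fin k → ℝ) × (ℕ × Fin m → Fin k) × (ℕ × Fin m → ℝ) → ENNReal,
      Measurable f → ∫⁻ ω, f ω ∂(law m P ε) = ∫⁻ r, ∫⁻ x, ∫⁻ u, ∫⁻ z, ∫⁻ y,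
        f (Function.update r (c.1, c.2, b) x, u, Function.update z c y)
        ∂(laplace ε) ∂(noiseLaw m ε) ∂(coinLaw m k) ∂(P b) ∂(rewardLaw m P) := by
    intro f hf
    rw [law, lintegral_prod _ hf.aemeasurable, rewardLaw,
      lintegral_infinitePi_eq_lintegral_update (μ := fun i : ℕ × Fin m × Fin k => P i.2.2)
        (c.1, c.2, b) hf.lintegral_prod_right']
    refine lintegral_congr fun r => lintegral_congr fun x => ?_
    rw [lintegral_prod (fun q => f (Function.update r (c.1, c.2, b) x, q))
      (hf.comp measurable_prodMk_left).aemeasurable]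
    refine lintegral_congr fun u => ?_
    exact lintegral_infinitePi_eq_lintegral_update (μ := fun _ => laplace ε) c
      (hf.comp (measurable_prodMk_left.comp measurable_prodMk_left))
  have hX : Measurable fun ω : (ℕ × Fin m × Fin k → ℝ) × (ℕ × Fin m → Fin k) × (ℕ × Fin m → ℝ) =>
      privatise ω.1 ω.2.2 (c.1, c.2, b) := by
    unfold privatise; fun_prop
  rw [hup (fun ω => F ω * g (privatise ω.1 ω.2.2 (c.1, c.2, b))) (hF.mul (hg.comp hX)), hup _ hF]
  simp only [hinv, privatise, Function.update_self, Prod.mk.eta, lintegral_const, measure_univ,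
    mul_one]
  have hFz : ∀ r u, Measurable fun z => F (r, u, z) := fun r u =>
    hF.comp (measurable_prodMk_left.comp measurable_prodMk_left)
  have hFuz : ∀ r, Measurable fun q : (ℕ × Fin m → Fin k) × (ℕ × Fin m → ℝ) => F (r, q) := fun r =>
    hF.comp measurable_prodMk_left
  have hgy : ∀ x, Measurable fun y => g (x + y) := fun x => hg.comp (measurable_const_add x)
  have hgx : Measurable fun x => ∫⁻ y, g (x + y) ∂(laplace ε) := hgm.lintegral_prod_right'
  have hFr : Measurable fun r => ∫⁻ u, ∫⁻ z, F (r, u, z) ∂(noiseLaw m ε) ∂(coinLaw m k) := by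
    have h : (fun r => ∫⁻ u, ∫⁻ z, F (r, u, z) ∂(noiseLaw m ε) ∂(coinLaw m k)) =
        fun r => ∫⁻ q, F (r, q) ∂((coinLaw m k).prod (noiseLaw m ε)) :=
      funext fun r => (lintegral_prod _ (hFuz r).aemeasurable).symm
    rw [h]
    exact hF.lintegral_prod_right'
  rw [← lintegral_mul_const _ hFr]
  refine lintegral_congr fun r => ?_
  rw [← lintegral_const_mul _ hgx]
  refine lintegral_congr fun x => ?_
  rw [← lintegral_mul_const _ (hFuz r).lintegral_prod_right']
  refine lintegral_congr fun u => ?_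
  rw [← lintegral_mul_const _ (hFz r u)]
  refine lintegral_congr fun z => ?_
  rw [lintegral_const_mul _ (hgy x)]

section weight

variable {π : Quack.Policy k} {d : Fin m → ℕ} {v : Fin m}

open Quack

/-- The sample space. -/
abbrev Sample (m k : ℕ) : Type :=
  (ℕ × Fin m × Fin k → ℝ) × (ℕ × Fin m → Fin k) × (ℕ × Fin m → ℝ)

/-- What is observed at the round-agent pairs in `L`. -/
def obsOn (π : Quack.Policy k) (d : Fin m → ℕ) (v : Fin m) (L : List (ℕ × Fin m))
    (ω : Sample m k) : List (Fin k × ℝ) :=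
  obs π d v ω.2.1 (privatise ω.1 ω.2.2) L

lemma measurable_privatise_sample {m k : ℕ} :
    Measurable fun ω : Sample m k => privatise ω.1 ω.2.2 :=
  measurable_privatise.comp (measurable_fst.prodMk (measurable_snd.comp measurable_snd))

lemma measurable_act_sample (hd : ∀ w, w ≠ v → 0 < d w)
    (hπ : MeasurablePolicy (ℕ × Fin m × Fin k) π) (c : ℕ × Fin m) :
    Measurable fun ω : Sample m k => act π d v ω.2.1 (privatise ω.1 ω.2.2) c :=
  measurable_act hd hπ (measurable_fst.comp measurable_snd) measurable_privatise_sample c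

lemma measurable_plays_obsOn (hd : ∀ w, w ≠ v → 0 < d w)
    (hπ : MeasurablePolicy (ℕ × Fin m × Fin k) π) (b : Fin k) (L : List (ℕ × Fin m)) :
    Measurable fun ω => plays (obsOn π d v L ω) b := by
  induction L with
  | nil => exact measurable_const
  | cons c L ih =>
    have : (fun ω => plays (obsOn π d v (c :: L) ω) b) = fun ω => plays (obsOn π d v L ω) b +
        if act π d v ω.2.1 (privatise ω.1 ω.2.2) c = b then 1 else 0 := by
      funext ω
      simp [plays, obsOn, obs, List.countP_cons]
    rw [this]
    exact ih.add (Measurable.ite (measurable_act_sample hd hπ c (measurableSet_singleton b))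
      measurable_const measurable_const)

lemma measurableSet_counted (hd : ∀ w, w ≠ v → 0 < d w)
    (hπ : MeasurablePolicy (ℕ × Fin m × Fin k) π) (b : Fin k) (N : ℕ) (L : List (ℕ × Fin m))
    (c : ℕ × Fin m) :
    MeasurableSet {ω : Sample m k | act π d v ω.2.1 (privatise ω.1 ω.2.2) c = b ∧
      plays (obsOn π d v L ω) b < N} :=
  (measurable_act_sample hd hπ c (measurableSet_singleton b)).inter
    (measurableSet_lt (measurable_plays_obsOn hd hπ b L) measurable_const)

lemma weight_obsOn_append (g : ℝ → ENNReal) (b : Fin k) (N : ℕ) (L : List (ℕ × Fin m))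
    (c : ℕ × Fin m) (ω : Sample m k) :
    weight g b N (obsOn π d v (L ++ [c]) ω) = weight g b N (obsOn π d v L ω) *
      if act π d v ω.2.1 (privatise ω.1 ω.2.2) c = b ∧ plays (obsOn π d v L ω) b < N then
        g (privatise ω.1 ω.2.2 (c.1, c.2, b)) else 1 := by
  simp only [obsOn, obs_append, obs_singleton, weight_append_singleton]
  congr 1
  refine if_ctx_congr Iff.rfl (fun h => ?_) fun _ => rfl
  rw [h.1]

lemma measurable_weight_obsOn (hd : ∀ w, w ≠ v → 0 < d w)
    (hπ : MeasurablePolicy (ℕ × Fin m × Fin k) π) {g : ℝ → ENNReal} (hg : Measurable g) (b : Fin k)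
    (N : ℕ) (L : List (ℕ × Fin m)) : Measurable fun ω => weight g b N (obsOn π d v L ω) := by
  induction L using List.reverseRecOn with
  | nil => simp [obsOn, weight]
  | append_singleton L c ih =>
    simp only [weight_obsOn_append]
    exact ih.mul (Measurable.ite (measurableSet_counted hd hπ b N L c)
      (hg.comp ((measurable_pi_apply _).comp measurable_privatise_sample)) measurable_const)

variable [∀ a, IsProbabilityMeasure (P a)]

/-- Whether c contributes a factor is decided by the action at c and by the observations in L, none
of which depends on the reward at c. The new factor is thus independent of the rest, with mean at
most 1. -/
lemma lintegral_weight_append_le (hε : 0 < ε) (hd : ∀ w, w ≠ v → 0 < d w)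
    (hπ : MeasurablePolicy (ℕ × Fin m × Fin k) π) {g : ℝ → ENNReal} (hg : Measurable g) {b : Fin k}
    (hgb : ∫⁻ x, ∫⁻ y, g (x + y) ∂(laplace ε) ∂(P b) ≤ 1) (N : ℕ) {L : List (ℕ × Fin m)}
    {c : ℕ × Fin m} (hc : c ∉ L)
    (hdep : ∀ u (X X' : ℕ × Fin m × Fin k → ℝ), (∀ b ≠ c, ∀ a, X (b.1, b.2, a) = X' (b.1, b.2, a)) →
      ∀ c' ∈ L ++ [c], act π d v u X c' = act π d v u X' c') :
    ∫⁻ ω, weight g b N (obsOn π d v (L ++ [c]) ω) ∂(law m P ε) ≤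
      ∫⁻ ω, weight g b N (obsOn π d v L ω) ∂(law m P ε) := by
  classical
  set S : Set (Sample m k) := {ω | act π d v ω.2.1 (privatise ω.1 ω.2.2) c = b ∧
      plays (obsOn π d v L ω) b < N} with hS
  have hSm : MeasurableSet S := measurableSet_counted hd hπ b N L c
  set W : Sample m k → ENNReal := fun ω => weight g b N (obsOn π d v L ω) with hW
  have hWm : Measurable W := measurable_weight_obsOn hd hπ hg b N L
  have hsplit : ∀ ω, weight g b N (obsOn π d v (L ++ [c]) ω) =
      S.indicator W ω * g (privatise ω.1 ω.2.2 (c.1, c.2, b)) + Sᶜ.indicator W ω := by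
    intro ω
    rw [weight_obsOn_append]
    by_cases h : ω ∈ S
    · have h' : act π d v ω.2.1 (privatise ω.1 ω.2.2) c = b ∧ plays (obsOn π d v L ω) b < N := h
      simp [h, h', hW]
    · have h' : ¬(act π d v ω.2.1 (privatise ω.1 ω.2.2) c = b ∧ plays (obsOn π d v L ω) b < N) := h
      simp only [h', if_false, mul_one]
      simp [h, hW]
  have hinv : ∀ r u z x y, S.indicator W
      (Function.update r (c.1, c.2, b) x, u, Function.update z c y) = S.indicator W (r, u, z) := by
    intro r u z x y
    have hag : ∀ b' ≠ c, ∀ a,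
        privatise (Function.update r (c.1, c.2, b) x) (Function.update z c y) (b'.1, b'.2, a) =
          privatise r z (b'.1, b'.2, a) := by
      intro b' hb' a
      have hne : (b'.1, b'.2, a) ≠ (c.1, c.2, b) := fun h => by
        simp only [Prod.mk.injEq] at h
        exact hb' (Prod.ext h.1 h.2.1)
      simp [privatise, Function.update_of_ne hne, Function.update_of_ne hb']
    have hact := hdep u _ _ hag
    have hobs : obsOn π d v L (Function.update r (c.1, c.2, b) x, u, Function.update z c y) =
        obsOn π d v L (r, u, z) := by
      refine List.map_congr_left fun c' hc' => ?_
      simp only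
      rw [hact c' (by simp [hc']), hag c' (fun h => hc (h ▸ hc'))]
    simp only [Set.indicator, hS, hW, Set.mem_ofPred_eq, hobs, hact c (by simp)]
  simp only [hsplit]
  rw [lintegral_add_right _ (hWm.indicator hSm.compl),
    lintegral_law_mul hε c b (hWm.indicator hSm) hinv hg]
  refine (add_le_add_left (mul_le_of_le_one_right' hgb) _).trans ?_
  rw [← lintegral_add_left (hWm.indicator hSm)]
  refine le_of_eq (lintegral_congr fun ω => ?_)
  by_cases h : ω ∈ S <;> simp [h, hW]

/-- The weight of what the leader learns is a supermartingale. -/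
lemma lintegral_weight_arrivals_le (hε : 0 < ε) (hv : d v = 0) (hd : ∀ w, w ≠ v → 0 < d w)
    (hπ : MeasurablePolicy (ℕ × Fin m × Fin k) π) {g : ℝ → ENNReal} (hg : Measurable g) {b : Fin k}
    (hgb : ∫⁻ x, ∫⁻ y, g (x + y) ∂(laplace ε) ∂(P b) ≤ 1) (N t : ℕ) :
    ∫⁻ ω, weight g b N (obsOn π d v (arrivals d v t) ω) ∂(law m P ε) ≤ 1 := by
  have hprob := isProbabilityMeasure_laplace hε
  have hC := isProbabilityMeasure_coinLaw (m := m) (k := k)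
  have hN := isProbabilityMeasure_noiseLaw (m := m) hε
  have hR := isProbabilityMeasure_rewardLaw (m := m) (P := P)
  induction t with
  | zero => simp [arrivals, obsOn, weight, law]
  | succ t ih =>
    have hmem : ∀ c ∈ arrivals d v t ++ msgCells d v t,
        c.1 + d c.2 ≤ t ∧ (c.2 ≠ v ∨ c.1 + d c.2 < t) := by
      intro c hc
      rcases List.mem_append.1 hc with h | h
      · rw [mem_arrivals hv] at h
        exact ⟨h.le, Or.inr h⟩
      · rw [mem_msgCells] at h
        exact ⟨h.2.le, Or.inl h.1⟩
    -- Messages are added one at a time: neither the places known before round t nor the followers'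
    -- places reported in it have actions depending on a reward that arrives in round t.
    have hmsg : ∀ M, M <+: msgCells d v t →
        ∫⁻ ω, weight g b N (obsOn π d v (arrivals d v t ++ M) ω) ∂(law m P ε) ≤ 1 := by
      intro M
      induction M using List.reverseRecOn with
      | nil => intro _; simpa using ih
      | append_singleton M c ihM =>
        intro hM
        have hMc : ∀ c' ∈ arrivals d v t ++ (M ++ [c]),
            c' ∈ arrivals d v t ++ msgCells d v t := fun c' hc' => by
          rcases List.mem_append.1 hc' with h | h
          · exact List.mem_append_left _ h
          · exact List.mem_append_right _ (hM.subset h)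
        obtain ⟨hcv, hct⟩ := mem_msgCells.1 (hM.subset (show c ∈ M ++ [c] by simp))
        rw [← List.append_assoc]
        refine (lintegral_weight_append_le hε hd hπ hg hgb N ?_ ?_).trans
          (ihM ((List.prefix_append _ _).trans hM))
        · intro h
          rcases List.mem_append.1 h with h | h
          · rw [mem_arrivals hv] at h
            omega
          · exact (List.nodup_append.1 ((nodup_msgCells t).sublist hM.sublist)).2.2 c h c
              (by simp) rfl
        · intro u X X' hX c' hc'
          rw [List.append_assoc] at hc'
          obtain ⟨h1, h2⟩ := hmem c' (hMc c' hc')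
          exact act_congr_off hv hd hX (by omega) (by omega)
    -- The leader's own place comes last: its action may depend on the messages of the round, but
    -- not on its own reward.
    refine (lintegral_weight_append_le hε hd hπ hg hgb N ?_ ?_).trans (hmsg _ (List.prefix_refl _))
    · intro h
      have := (hmem _ h).2
      simp [hv] at this
    · intro u X X' hX c' hc'
      rcases List.mem_append.1 hc' with h | h
      · obtain ⟨h1, h2⟩ := hmem c' h
        exact act_congr_off hv hd hX (by simp only [hv]; omega) (Or.inr (Or.inr rfl))
      · rw [List.mem_singleton.1 h]
        exact act_congr_off hv hd hX le_rfl (Or.inr (Or.inr rfl))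

end weight

end LDP

/-! ### Exponential weights and confidence widths -/

namespace LDP

/-- The exponential weight of a reward with mean `μ`, normalised for rewards in `[0, 1]` that have been
privatised by the Laplace mechanism. -/
noncomputable def expWeight (ε μ l x : ℝ) : ENNReal :=
  ENNReal.ofReal (Real.exp (l * (x - μ) - l ^ 2 * (1 / 8 + 2 / ε ^ 2)))

lemma measurable_expWeight (ε μ l : ℝ) : Measurable (expWeight ε μ l) := by
  unfold expWeight; fun_prop

/-- Hoeffding's lemma gives exp(l²/8) for the raw reward. With q = l²/ε² ≤ 1/2 the noise contributes
1/(1 - q) ≤ exp(2q), because (1 + 2q)(1 - q) ≥ 1. -/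
lemma lintegral_expWeight_le {ε l : ℝ} (hε : 0 < ε) (hl : l ^ 2 ≤ ε ^ 2 / 2) (P : Measure ℝ)
    [IsProbabilityMeasure P] (hP : ∀ᵐ x ∂P, x ∈ Set.Icc (0 : ℝ) 1) :
    ∫⁻ x, ∫⁻ y, expWeight ε (∫ x, x ∂P) l (x + y) ∂(laplace ε) ∂P ≤ 1 := by
  set μ := ∫ x, x ∂P with hμ
  have hlt : |l| < ε := by
    apply lt_of_pow_lt_pow_left₀ 2 hε.le
    rw [sq_abs]
    have : 0 < ε ^ 2 := by positivity
    linarith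
  have hsub := ProbabilityTheory.hasSubgaussianMGF_of_mem_Icc (μ := P) (X := fun x : ℝ => x)
    aemeasurable_id hP
  have hmgf : ∫⁻ x, ENNReal.ofReal (Real.exp (l * (x - μ))) ∂P ≤
      ENNReal.ofReal (Real.exp (l ^ 2 / 8)) := by
    rw [← ofReal_integral_eq_lintegral_ofReal (hsub.integrable_exp_mul l)
      (ae_of_all _ fun _ => (Real.exp_pos _).le)]
    apply ENNReal.ofReal_le_ofReal
    refine (hsub.mgf_le l).trans (Real.exp_le_exp.2 (le_of_eq ?_))
    simp
    ring
  have hsplit : ∀ x y, expWeight ε μ l (x + y) =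
      ENNReal.ofReal (Real.exp (-(l ^ 2 * (1 / 8 + 2 / ε ^ 2)))) *
        (ENNReal.ofReal (Real.exp (l * (x - μ))) * ENNReal.ofReal (Real.exp (l * y))) := by
    intro x y
    rw [← ENNReal.ofReal_mul (Real.exp_pos _).le, ← ENNReal.ofReal_mul (Real.exp_pos _).le,
      ← Real.exp_add, ← Real.exp_add, expWeight]
    congr 2
    ring
  simp only [hsplit]
  simp only [lintegral_const_mul' _ _ ENNReal.ofReal_ne_top, lintegral_exp_laplace hlt]
  rw [lintegral_mul_const' _ _ ENNReal.ofReal_ne_top]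
  calc _ ≤ ENNReal.ofReal (Real.exp (-(l ^ 2 * (1 / 8 + 2 / ε ^ 2)))) *
        (ENNReal.ofReal (Real.exp (l ^ 2 / 8)) *
          ENNReal.ofReal (Real.exp (2 * (l ^ 2 / ε ^ 2)))) := by
        gcongr
        have hq : l ^ 2 / ε ^ 2 ≤ 1 / 2 := by
          rw [div_le_div_iff₀ (by positivity) (by norm_num)]
          linarith
        have hq0 : 0 ≤ l ^ 2 / ε ^ 2 := by positivity
        have he : ε ^ 2 / (ε ^ 2 - l ^ 2) = (1 - l ^ 2 / ε ^ 2)⁻¹ := by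
          field_simp
        rw [he, inv_le_iff_one_le_mul₀ (by linarith)]
        nlinarith [Real.add_one_le_exp (2 * (l ^ 2 / ε ^ 2))]
    _ = 1 := by
        rw [← ENNReal.ofReal_mul (Real.exp_pos _).le, ← ENNReal.ofReal_mul (Real.exp_pos _).le,
          ← Real.exp_add, ← Real.exp_add, ENNReal.ofReal_eq_one, Real.exp_eq_one_iff]
        ring

lemma prod_map_expWeight (ε μ l : ℝ) (L : List ℝ) :
    (L.map (expWeight ε μ l)).prod = ENNReal.ofReal (Real.exp
      (l * (L.sum - L.length * μ) - L.length * (l ^ 2 * (1 / 8 + 2 / ε ^ 2)))) := by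
  induction L with
  | nil => simp
  | cons x L ih =>
    rw [List.map_cons, List.prod_cons, ih, expWeight, ← ENNReal.ofReal_mul (Real.exp_pos _).le,
      ← Real.exp_add]
    congr 2
    simp only [List.sum_cons, List.length_cons, Nat.cast_add, Nat.cast_one]
    ring

/-- Half the width of the confidence interval of LDP-UCB-L after `N` plays of an action out of `s`. -/
noncomputable def bonus (ε : ℝ) (s N : ℕ) : ℝ :=
  √(2 * Real.log (s + 1) / N) + √(32 * Real.log (s + 1) / (ε ^ 2 * N))

lemma ucb_eq {k : ℕ} (ε : ℝ) (H : List (Fin k × ℝ)) (a : Fin k) :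
    ucb ε H a = empMean H a + bonus ε H.length (plays H a) := by
  rw [ucb, bonus, add_assoc]

/-- The exponential rate that is optimal for a deviation by `bonus ε s N`. -/
noncomputable def rate (ε : ℝ) (s N : ℕ) : ℝ :=
  4 * √(Real.log (s + 1) / N) / √(1 / 2 + 8 / ε ^ 2)

lemma log_succ_nonneg (s : ℕ) : 0 ≤ Real.log (s + 1) :=
  Real.log_nonneg (by linarith [s.cast_nonneg (α := ℝ)])

lemma rate_nonneg (ε : ℝ) (s N : ℕ) : 0 ≤ rate ε s N := by
  unfold rate; positivity

lemma rate_sq {ε : ℝ} (hε : 0 < ε) (s N : ℕ) :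
    rate ε s N ^ 2 = 16 * (Real.log (s + 1) / N) / (1 / 2 + 8 / ε ^ 2) := by
  have := log_succ_nonneg s
  rw [rate, div_pow, mul_pow, Real.sq_sqrt (by positivity), Real.sq_sqrt (by positivity)]
  norm_num

/-- The purpose of forced exploration: it keeps the rate within the range where the Laplace moment
bound holds. -/
lemma rate_sq_le {ε : ℝ} (hε : 0 < ε) {s N : ℕ} (hN : 4 * Real.log (s + 1) ≤ N) :
    rate ε s N ^ 2 ≤ ε ^ 2 / 2 := by
  rw [rate_sq hε]
  have hlog := log_succ_nonneg s
  have h1 : Real.log (s + 1) / N ≤ 1 / 4 := by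
    -- For N = 0 the quotient is 0 by convention.
    rcases N.eq_zero_or_pos with rfl | hpos
    · simp
    · rw [div_le_div_iff₀ (by exact_mod_cast hpos) (by norm_num)]
      linarith
  rw [div_le_iff₀ (by positivity)]
  have h2 : ε ^ 2 / 2 * (1 / 2 + 8 / ε ^ 2) = ε ^ 2 / 4 + 4 := by field_simp; ring
  rw [h2]
  have : 0 ≤ ε ^ 2 := by positivity
  linarith

/-- (√x + √y)² ≥ x + y, where x + y is the squared width for the combined variance proxy 1/2 + 8/ε².
-/
lemma le_bonus {ε : ℝ} (hε : 0 < ε) (s N : ℕ) :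
    2 * √(Real.log (s + 1) / N) * √(1 / 2 + 8 / ε ^ 2) ≤ bonus ε s N := by
  have hlog := log_succ_nonneg s
  refine (pow_le_pow_iff_left₀ (by positivity) (by unfold bonus; positivity) two_ne_zero).1 ?_
  rw [mul_pow, mul_pow, Real.sq_sqrt (by positivity), Real.sq_sqrt (by positivity), bonus, add_sq,
    Real.sq_sqrt (by positivity), Real.sq_sqrt (by positivity)]
  have h : 32 * Real.log (s + 1) / (ε ^ 2 * N) = 32 / ε ^ 2 * (Real.log (s + 1) / N) := by
    rw [mul_div_mul_comm]
  have h' : 0 ≤ 2 * √(2 * Real.log (s + 1) / N) * √(32 * Real.log (s + 1) / (ε ^ 2 * N)) := by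
    positivity
  rw [h] at h' ⊢
  have : 2 ^ 2 * (Real.log (s + 1) / N) * (1 / 2 + 8 / ε ^ 2) =
    2 * Real.log (s + 1) / N + 32 / ε ^ 2 * (Real.log (s + 1) / N) := by ring
  linarith

/-- (x + y)² ≤ 2(x² + y²), so 16 = 4·2·2 and 256 = 4·2·32. -/
lemma bonus_sq_le {ε : ℝ} (hε : 0 < ε) (s N : ℕ) :
    (2 * bonus ε s N) ^ 2 ≤ (16 * ε ^ 2 + 256) / ε ^ 2 * (Real.log (s + 1) / N) := by
  have hlog := log_succ_nonneg s
  have h := add_sq_le (a := √(2 * Real.log (s + 1) / N))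
    (b := √(32 * Real.log (s + 1) / (ε ^ 2 * N)))
  rw [Real.sq_sqrt (by positivity), Real.sq_sqrt (by positivity)] at h
  have h1 : 32 * Real.log (s + 1) / (ε ^ 2 * N) = 32 / ε ^ 2 * (Real.log (s + 1) / N) := by
    rw [mul_div_mul_comm]
  have h2 : (16 * ε ^ 2 + 256) / ε ^ 2 = 16 + 256 / ε ^ 2 := by field_simp
  have h3 : 2 * Real.log (s + 1) / N = 2 * (Real.log (s + 1) / N) := by ring
  have h4 : 2 ^ 2 * (2 * (2 * (Real.log (s + 1) / N) + 32 / ε ^ 2 * (Real.log (s + 1) / N))) =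
      (16 + 256 / ε ^ 2) * (Real.log (s + 1) / N) := by ring
  rw [h2, mul_pow, bonus, ← h4, ← h1, ← h3]
  exact mul_le_mul_of_nonneg_left h (by norm_num)

/-- The exponent gained by a deviation by `bonus ε s N`. -/
lemma four_log_le {ε : ℝ} (hε : 0 < ε) {s N : ℕ} (hN : 0 < N) {y : ℝ} (hy : N * bonus ε s N ≤ y) :
    4 * Real.log (s + 1) ≤
      rate ε s N * y - N * (rate ε s N ^ 2 * (1 / 8 + 2 / ε ^ 2)) := by
  have hlog := log_succ_nonneg s
  have hN' : (0 : ℝ) < N := by exact_mod_cast hN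
  have hpos : 0 < 1 / 2 + 8 / ε ^ 2 := by positivity
  -- After multiplication by N the linear term gains at least 8 log(s+1) and the quadratic one costs
  -- 4 log(s+1).
  have h1 : rate ε s N * (2 * √(Real.log (s + 1) / N) * √(1 / 2 + 8 / ε ^ 2)) =
      8 * (Real.log (s + 1) / N) := by
    have hne : √(1 / 2 + 8 / ε ^ 2) ≠ 0 := (Real.sqrt_pos.2 hpos).ne'
    rw [rate, div_mul_eq_mul_div, div_eq_iff hne]
    linear_combination 8 * √(1 / 2 + 8 / ε ^ 2) *
      Real.sq_sqrt (show 0 ≤ Real.log (s + 1) / N by positivity)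
  have h2 : rate ε s N ^ 2 * (1 / 8 + 2 / ε ^ 2) = 4 * (Real.log (s + 1) / N) := by
    rw [rate_sq hε, show (1 : ℝ) / 8 + 2 / ε ^ 2 = (1 / 2 + 8 / ε ^ 2) / 4 by ring]
    field_simp
    ring
  have h3 : 8 * (Real.log (s + 1) / N) ≤ rate ε s N * bonus ε s N :=
    h1 ▸ mul_le_mul_of_nonneg_left (le_bonus hε s N) (rate_nonneg _ _ _)
  have h4 : rate ε s N * (N * bonus ε s N) ≤ rate ε s N * y :=
    mul_le_mul_of_nonneg_left hy (rate_nonneg _ _ _)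
  have h5 : N * (Real.log (s + 1) / N) = Real.log (s + 1) := by field_simp
  rw [h2]
  nlinarith

/-- If the empirical mean of the first `N` rewards of `b` is far above (`σ = 1`) or below (`σ = -1`)
`μ`, then the corresponding exponential weight is large. -/
lemma le_weight_of_deviation {k : ℕ} {ε μ σ : ℝ} (hε : 0 < ε) (hσ : σ ^ 2 = 1) {b : Fin k}
    {H H' : List (Fin k × ℝ)} (hpre : Quack.samples H b <+: Quack.samples H' b) {s : ℕ}
    (hN : 0 < plays H b) (h : bonus ε s (plays H b) ≤ σ * (empMean H b - μ)) :
    ENNReal.ofReal ((s + 1) ^ 4) ≤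
      Quack.weight (expWeight ε μ (σ * rate ε s (plays H b))) b (plays H b) H' := by
  have htake : (Quack.samples H' b).take (plays H b) = Quack.samples H b := by
    rw [← Quack.length_samples]
    exact (List.prefix_iff_eq_take.1 hpre).symm
  rw [Quack.weight, htake, prod_map_expWeight, Quack.length_samples]
  have hN' : (0 : ℝ) < plays H b := by exact_mod_cast hN
  have hsum : (Quack.samples H b).sum = plays H b * empMean H b := by
    rw [empMean]
    field_simp
    rfl
  apply ENNReal.ofReal_le_ofReal
  have hs : (0 : ℝ) < s + 1 := by positivity
  rw [← Real.exp_log hs, ← Real.exp_nat_mul, Real.exp_le_exp]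
  refine (four_log_le hε hN (mul_le_mul_of_nonneg_left h hN'.le)).trans (le_of_eq ?_)
  rw [mul_pow, hσ, hsum]
  ring

/-! ### LDP-UCB-L on a fixed history -/

section ucb

variable {k : ℕ} [NeZero k] {ε : ℝ}

/-- A forced choice is itself under-sampled, so a well-sampled choice can only come from the
maximisation. -/
lemma lt_plays_of_ldpUcbL {H : List (Fin k × ℝ)}
    (h : 4 * Real.log (H.length + 1) < plays H (ldpUcbL ε H)) :
    (∀ b, 4 * Real.log (H.length + 1) < plays H b) ∧ ∀ b, ucb ε H b ≤ ucb ε H (ldpUcbL ε H) := by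
  have hne : ¬(underSampled H).Nonempty := by
    intro hne
    have hmem := Finset.min'_mem _ hne
    have heq : ldpUcbL ε H = (underSampled H).min' hne := by simp only [ldpUcbL, hne, dite_true]
    rw [← heq] at hmem
    simp only [underSampled, Finset.mem_filter, Finset.mem_univ, true_and] at hmem
    exact absurd hmem (not_le.2 h)
  refine ⟨fun b => ?_, ?_⟩
  · by_contra hb
    exact hne ⟨b, by simpa [underSampled] using hb⟩
  · have hmem := Finset.min'_mem _ (maximisers_nonempty ε H)
    have heq : ldpUcbL ε H = (maximisers ε H).min' (maximisers_nonempty ε H) := by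
      simp only [ldpUcbL, hne, dite_false]
    rw [← heq] at hmem
    simpa [maximisers] using hmem

/-- If LDP-UCB-L plays a bad action that it has often played before, then one of the empirical means
is far off. -/
lemma deviation_of_ldpUcbL (hε : 0 < ε) (μ : Fin k → ℝ) {a b : Fin k} (hΔ : 0 < μ b - μ a)
    {H : List (Fin k × ℝ)} (ha : ldpUcbL ε H = a)
    (h4 : 4 * Real.log (H.length + 1) < plays H a)
    (hN : (16 * ε ^ 2 + 256) / ε ^ 2 * Real.log (H.length + 1) / (μ b - μ a) ^ 2 ≤ plays H a) :
    bonus ε H.length (plays H a) ≤ 1 * (empMean H a - μ a) ∨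
      4 * Real.log (H.length + 1) < plays H b ∧
        bonus ε H.length (plays H b) ≤ -1 * (empMean H b - μ b) := by
  have hlog := log_succ_nonneg H.length
  have hN0 : (0 : ℝ) < plays H a := by linarith
  obtain ⟨h1, h2⟩ := lt_plays_of_ldpUcbL (ε := ε) (H := H) (by rw [ha]; exact h4)
  -- Otherwise μ b < ucb b ≤ ucb a < μ a + 2 · bonus, whereas the assumed number of plays makes 2 ·
  -- bonus at most the gap.
  by_contra! hcon
  obtain ⟨hca, hcb⟩ := hcon
  have hcb := hcb (h1 b)
  have hub := h2 b
  rw [ha, ucb_eq, ucb_eq] at hub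
  have hlt : μ b - μ a < 2 * bonus ε H.length (plays H a) := by linarith
  have hsq : (μ b - μ a) ^ 2 < (2 * bonus ε H.length (plays H a)) ^ 2 :=
    pow_lt_pow_left₀ hlt hΔ.le two_ne_zero
  have hle := bonus_sq_le hε H.length (plays H a)
  rw [div_le_iff₀ (by positivity)] at hN
  have : (16 * ε ^ 2 + 256) / ε ^ 2 * (Real.log (H.length + 1) / plays H a) ≤ (μ b - μ a) ^ 2 := by
    rw [← mul_div_assoc, div_le_iff₀ hN0]
    linarith
  linarith

/-- Counting the plays of `a` beyond the first `U`. -/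
lemma plays_le_add_card {k : ℕ} {U : ℝ} (hU : 0 ≤ U) {a : Fin k} {B : List (Fin k × ℝ) → Prop}
    [DecidablePred B] {H : List (Fin k × ℝ)}
    (h : ∀ H' p, H' ++ [p] <+: H → p.1 = a → U < plays H' a → B H') :
    (plays H a : ℝ) ≤ U + 1 + ((Finset.range H.length).filter fun s => B (H.take s)).card := by
  induction H using List.reverseRecOn with
  | nil => simp [plays]; linarith
  | append_singleton H p ih =>
    have ih := ih fun H' q hq => h H' q (hq.trans (List.prefix_append _ _))
    have hset : ((Finset.range (H ++ [p]).length).filter fun s => B ((H ++ [p]).take s)).card =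
        ((Finset.range H.length).filter fun s => B (H.take s)).card + if B H then 1 else 0 := by
      rw [List.length_append, List.length_singleton, Finset.range_add_one, Finset.filter_insert]
      have hcongr : ((Finset.range H.length).filter fun s => B ((H ++ [p]).take s)) =
          (Finset.range H.length).filter fun s => B (H.take s) := by
        refine Finset.filter_congr fun s hs => ?_
        rw [List.take_append_of_le_length (Finset.mem_range.1 hs).le]
      rw [hcongr]
      by_cases hB : B H <;> simp [hB]
    have hplays : plays (H ++ [p]) a = plays H a + if p.1 = a then 1 else 0 := by
      simp [plays, List.countP_append, List.countP_singleton]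
    rw [hset, hplays]
    push_cast
    by_cases hp : p.1 = a
    · by_cases hUH : U < plays H a
      · have := h H p (List.prefix_refl _) hp hUH
        simp only [hp, this, if_true]
        linarith
      -- No event is charged here: the count was at most U, so it is at most U + 1 after this play.
      · simp only [hp, if_true]
        have h0 : (0 : ℝ) ≤ (((Finset.range H.length).filter fun s => B (H.take s)).card : ℝ) := by
          positivity
        have h1 : (0 : ℝ) ≤ if B H then (1 : ℕ) else 0 := by positivity
        push_cast at h1 ⊢
        linarith
    · have h1 : (0 : ℝ) ≤ if B H then (1 : ℕ) else 0 := by positivity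
      simp only [hp, if_false]
      push_cast at h1 ⊢
      linarith

end ucb

end LDP

/-! ### Expected regret -/

namespace LDP

open Quack

variable {m k : ℕ} [NeZero k] {P : Fin k → Measure ℝ} {ε : ℝ} {π : Quack.Policy k} {d : Fin m → ℕ}
  {v : Fin m}

lemma isProbabilityMeasure_law [∀ a, IsProbabilityMeasure (P a)] (hε : 0 < ε) :
    IsProbabilityMeasure (law m P ε) := by
  have hC := isProbabilityMeasure_coinLaw (m := m) (k := k)
  have hN := isProbabilityMeasure_noiseLaw (m := m) hε
  have hR := isProbabilityMeasure_rewardLaw (m := m) (P := P)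
  unfold law; infer_instance

/-- The event that, by round `n`, the first `N` rewards of `b` known to the leader have a large
exponential weight. -/
def deviationEvent (P : Fin k → Measure ℝ) (ε : ℝ) (π : Quack.Policy k) (d : Fin m → ℕ) (v : Fin m)
    (n : ℕ) (b : Fin k) (σ : ℝ) (s N : ℕ) : Set (Sample m k) :=
  {ω | ENNReal.ofReal ((s + 1) ^ 4) ≤ weight (expWeight ε (∫ x, x ∂(P b)) (σ * rate ε s N)) b N
    (obsOn π d v (arrivals d v n) ω)}

lemma measurableSet_deviationEvent (hd : ∀ w, w ≠ v → 0 < d w)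
    (hπ : MeasurablePolicy (ℕ × Fin m × Fin k) π) (n : ℕ) (b : Fin k) (σ : ℝ) (s N : ℕ) :
    MeasurableSet (deviationEvent P ε π d v n b σ s N) :=
  measurableSet_le measurable_const (measurable_weight_obsOn hd hπ (measurable_expWeight _ _ _) b N _)

/-- Markov's inequality for a weight of mean at most 1. -/
lemma law_deviationEvent_le [∀ a, IsProbabilityMeasure (P a)] (hε : 0 < ε) (hv : d v = 0)
    (hd : ∀ w, w ≠ v → 0 < d w) (hπ : MeasurablePolicy (ℕ × Fin m × Fin k) π) {b : Fin k}
    (hP : ∀ᵐ x ∂(P b), x ∈ Set.Icc (0 : ℝ) 1) {σ : ℝ} (hσ : σ ^ 2 = 1) {s N : ℕ}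
    (hN : 4 * Real.log (s + 1) ≤ N) (n : ℕ) :
    (law m P ε).real (deviationEvent P ε π d v n b σ s N) ≤ (((s : ℝ) + 1) ^ 4)⁻¹ := by
  have hpos : (0 : ℝ) < ((s : ℝ) + 1) ^ 4 := by positivity
  have h := (mul_meas_ge_le_lintegral (μ := law m P ε) (measurable_weight_obsOn hd hπ
      (measurable_expWeight ε (∫ x, x ∂(P b)) (σ * rate ε s N)) b N (arrivals d v n))
      (ENNReal.ofReal ((s + 1) ^ 4))).trans
    (lintegral_weight_arrivals_le hε hv hd hπ (measurable_expWeight _ _ _)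
      (lintegral_expWeight_le hε (by rw [mul_pow, hσ, one_mul]; exact rate_sq_le hε hN) (P b) hP)
      N n)
  rw [← one_div, le_div_iff₀ hpos, mul_comm, measureReal_def,
    ← ENNReal.toReal_ofReal hpos.le, ← ENNReal.toReal_mul, ← ENNReal.toReal_one]
  exact ENNReal.toReal_mono ENNReal.one_ne_top h

/-- The event that an empirical mean of the bad action `a` or of the good action `b` after `s` plays
is far off. -/
def badEvent (P : Fin k → Measure ℝ) (ε : ℝ) (π : Quack.Policy k) (d : Fin m → ℕ) (v : Fin m)
    (n : ℕ) (a b : Fin k) (s : ℕ) : Set (Sample m k) :=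
  ⋃ N ∈ (Finset.Icc 1 s).filter (fun N => 4 * Real.log (s + 1) < (N : ℕ)),
    (deviationEvent P ε π d v n a 1 s N ∪ deviationEvent P ε π d v n b (-1) s N)

lemma measurableSet_badEvent (hd : ∀ w, w ≠ v → 0 < d w)
    (hπ : MeasurablePolicy (ℕ × Fin m × Fin k) π) (n : ℕ) (a b : Fin k) (s : ℕ) :
    MeasurableSet (badEvent P ε π d v n a b s) :=
  Finset.measurableSet_biUnion _ fun _ _ => (measurableSet_deviationEvent hd hπ _ _ _ _ _).union
    (measurableSet_deviationEvent hd hπ _ _ _ _ _)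

/-- At most s values of N and two actions give 2s/(s+1)⁴. The bound is put in telescoping form so
that its sum over s is at most 4. -/
lemma law_badEvent_le [∀ a, IsProbabilityMeasure (P a)] (hε : 0 < ε) (hv : d v = 0)
    (hd : ∀ w, w ≠ v → 0 < d w) (hπ : MeasurablePolicy (ℕ × Fin m × Fin k) π)
    (hP : ∀ a, ∀ᵐ x ∂(P a), x ∈ Set.Icc (0 : ℝ) 1) (n : ℕ) (a b : Fin k) (s : ℕ) :
    (law m P ε).real (badEvent P ε π d v n a b s) ≤
      4 * (1 / ((s : ℝ) + 1) - 1 / (((s + 1 : ℕ) : ℝ) + 1)) := by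
  have hprob := isProbabilityMeasure_law (m := m) (P := P) hε
  refine (measureReal_biUnion_finset_le _ _).trans ?_
  have h : ∀ N ∈ (Finset.Icc 1 s).filter (fun N => 4 * Real.log (s + 1) < (N : ℕ)),
      (law m P ε).real (deviationEvent P ε π d v n a 1 s N ∪ deviationEvent P ε π d v n b (-1) s N) ≤
        2 * (((s : ℝ) + 1) ^ 4)⁻¹ := by
    intro N hN
    have hN' := (Finset.mem_filter.1 hN).2.le
    refine (measureReal_union_le _ _).trans ?_
    have h1 := law_deviationEvent_le hε hv hd hπ (hP a) (σ := 1) (by norm_num) hN' n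
    have h2 := law_deviationEvent_le hε hv hd hπ (hP b) (σ := -1) (by norm_num) hN' n
    linarith
  refine (Finset.sum_le_card_nsmul _ _ _ h).trans ?_
  have hcard : ((Finset.Icc 1 s).filter (fun N => 4 * Real.log (s + 1) < (N : ℕ))).card ≤ s := by
    simpa using Finset.card_filter_le (Finset.Icc 1 s) (fun N => 4 * Real.log (s + 1) < (N : ℕ))
  rw [nsmul_eq_mul]
  calc _ ≤ (s : ℝ) * (2 * (((s : ℝ) + 1) ^ 4)⁻¹) := by gcongr
    _ ≤ 4 * (1 / ((s : ℝ) + 1) - 1 / (((s + 1 : ℕ) : ℝ) + 1)) := by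
      have hs : (0 : ℝ) ≤ s := s.cast_nonneg
      have h1 : 4 * (1 / ((s : ℝ) + 1) - 1 / (((s + 1 : ℕ) : ℝ) + 1)) =
          4 / (((s : ℝ) + 1) * (s + 2)) := by
        push_cast
        have : (s : ℝ) + 1 + 1 = s + 2 := by ring
        rw [this]
        field_simp
        ring
      rw [h1, ← mul_assoc, ← div_eq_mul_inv, div_le_div_iff₀ (by positivity) (by positivity)]
      have : s * (s + 2) ≤ 2 * ((s : ℝ) + 1) ^ 3 := by nlinarith [pow_nonneg hs 3, pow_nonneg hs 2]
      nlinarith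

/-- The number of plays of a bad action `a` on every sample path. -/
lemma groupPlays_le {G : SimpleGraph (Fin m)} (hG : G.Connected) (hε : 0 < ε) {a b : Fin k}
    (hΔ : 0 < ∫ x, x ∂(P b) - ∫ x, x ∂(P a)) (hΔ1 : ∫ x, x ∂(P b) - ∫ x, x ∂(P a) ≤ 1) {n : ℕ}
    (hmn : 1 ≤ m * n) (ω : Sample m k) :
    (groupPlays (ldpUcbL ε) G v ω.2.1 (privatise ω.1 ω.2.2) n a : ℝ) ≤
      ((16 * ε ^ 2 + 256) / ε ^ 2 * Real.log (m * n) / (∫ x, x ∂(P b) - ∫ x, x ∂(P a)) ^ 2 + 1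
        + 2 * ∑ w, (G.dist v w : ℝ)) +
      ∑ s ∈ Finset.range (m * n),
        (badEvent P ε (ldpUcbL ε) (G.dist v) v n a b s).indicator 1 ω := by
  classical
  have hv : G.dist v v = 0 := SimpleGraph.dist_self
  have hd := dist_pos_of_ne (v := v) hG
  set X := privatise ω.1 ω.2.2 with hX
  set H := (leaderState (ldpUcbL ε) (G.dist v) v ω.2.1 X n).hist with hH
  set Δ := ∫ x, x ∂(P b) - ∫ x, x ∂(P a) with hΔdef
  have hlen : H.length ≤ m * n := length_hist_le _ _ _ hv hd n
  have hmn' : (1 : ℝ) ≤ m * n := by exact_mod_cast hmn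
  have hlogmn : 0 ≤ Real.log (m * n) := Real.log_nonneg hmn'
  set U := (16 * ε ^ 2 + 256) / ε ^ 2 * Real.log (m * n) / Δ ^ 2 with hU
  have hU0 : 0 ≤ U := by positivity
  have h1 : (groupPlays (ldpUcbL ε) G v ω.2.1 X n a : ℝ) ≤ plays H a + 2 * ∑ w, (G.dist v w : ℝ) := by
    have := sum_card_act_le (ldpUcbL ε) ω.2.1 X hv hd n a
    simp only [groupPlays, action_eq_act]
    exact_mod_cast this
  let B : List (Fin k × ℝ) → Prop := fun H' =>
    4 * Real.log (H'.length + 1) < plays H' a ∧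
      bonus ε H'.length (plays H' a) ≤ 1 * (empMean H' a - ∫ x, x ∂(P a)) ∨
    4 * Real.log (H'.length + 1) < plays H' b ∧
      bonus ε H'.length (plays H' b) ≤ -1 * (empMean H' b - ∫ x, x ∂(P b))
  have h2 : (plays H a : ℝ) ≤ U + 1 +
      ((Finset.range H.length).filter fun s => B (H.take s)).card := by
    refine plays_le_add_card (B := B) hU0 fun H' p hp hpa hUa => ?_
    have hact : ldpUcbL ε H' = a := by
      rw [← hpa]
      exact (consistent_hist (ldpUcbL ε) ω.2.1 X n H' p hp).symm
    have hlog : Real.log (H'.length + 1) ≤ Real.log (m * n) := by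
      have h := hp.length_le.trans hlen
      simp only [List.length_append, List.length_singleton] at h
      apply Real.log_le_log (by positivity)
      exact_mod_cast h
    have hlog0 := log_succ_nonneg H'.length
    -- As the gap is at most 1, U ≥ 16 log(mn), so forced plays of a are already covered by U.
    have h4 : 4 * Real.log (H'.length + 1) < plays H' a := by
      refine lt_of_le_of_lt ?_ hUa
      have hΔ2 : Δ ^ 2 ≤ 1 := pow_le_one₀ hΔ.le hΔ1
      rw [hU, le_div_iff₀ (by positivity)]
      have h16 : (16 * ε ^ 2 + 256) / ε ^ 2 = 16 + 256 / ε ^ 2 := by field_simp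
      have h256 : 0 ≤ 256 / ε ^ 2 * Real.log (m * n) := by positivity
      rw [h16]
      nlinarith
    have hdev := deviation_of_ldpUcbL hε (fun a => ∫ x, x ∂(P a)) hΔ hact h4 (by
      refine le_trans ?_ hUa.le
      rw [hU]
      gcongr)
    rcases hdev with h | h
    · exact Or.inl ⟨h4, h⟩
    · exact Or.inr h
  have h3 : (((Finset.range H.length).filter fun s => B (H.take s)).card : ℝ) ≤
      ∑ s ∈ Finset.range (m * n),
        (badEvent P ε (ldpUcbL ε) (G.dist v) v n a b s).indicator 1 ω := by
    have hsub : ((Finset.range H.length).filter fun s => B (H.take s)) ⊆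
        (Finset.range (m * n)).filter
          fun s => ω ∈ badEvent P ε (ldpUcbL ε) (G.dist v) v n a b s := by
      intro s hs
      simp only [Finset.mem_filter, Finset.mem_range] at hs ⊢
      obtain ⟨hs, hB⟩ := hs
      refine ⟨by omega, ?_⟩
      have hts : (H.take s).length = s := List.length_take_of_le hs.le
      -- The passage from the order of π to the order of arrival: a deviation in the history is one
      -- of the first N arrived rewards. The random N is covered by the union in `badEvent`.
      have hpre : ∀ c, samples (H.take s) c <+:
          samples (obsOn (ldpUcbL ε) (G.dist v) v (arrivals (G.dist v) v n) ω) c := by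
        intro c
        rw [obsOn, samples_obs_arrivals _ _ _ hv hd]
        exact (samples_prefix (List.take_prefix s H) c).trans (List.prefix_append _ _)
      have hle : ∀ c, plays (H.take s) c ≤ s := fun c =>
        List.countP_le_length.trans hts.le
      have hpos : ∀ c, 4 * Real.log (s + 1) < plays (H.take s) c → 0 < plays (H.take s) c :=
        fun c hc => by
          have := log_succ_nonneg s
          exact_mod_cast (show (0 : ℝ) < plays (H.take s) c by linarith)
      simp only [B, hts] at hB
      simp only [badEvent, Set.mem_iUnion, Finset.mem_filter, Finset.mem_Icc]
      rcases hB with ⟨hB4, hB⟩ | ⟨hB4, hB⟩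
      · exact ⟨_, ⟨⟨hpos a hB4, hle a⟩, hB4⟩, Or.inl
          (le_weight_of_deviation hε (by norm_num) (hpre a) (hpos a hB4) hB)⟩
      · exact ⟨_, ⟨⟨hpos b hB4, hle b⟩, hB4⟩, Or.inr
          (le_weight_of_deviation hε (by norm_num) (hpre b) (hpos b hB4) hB)⟩
    refine (Nat.cast_le.2 (Finset.card_le_card hsub)).trans (le_of_eq ?_)
    rw [Finset.card_filter]
    push_cast
    exact Finset.sum_congr rfl fun s _ => by simp [Set.indicator]
  linarith

lemma integrable_groupPlays {G : SimpleGraph (Fin m)} (hG : G.Connected) (hε : 0 < ε)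
    [∀ a, IsProbabilityMeasure (P a)] (hπ : MeasurablePolicy (ℕ × Fin m × Fin k) π) (n : ℕ)
    (a : Fin k) :
    Integrable (fun ω => (groupPlays π G v ω.2.1 (privatise ω.1 ω.2.2) n a : ℝ)) (law m P ε) := by
  have hprob := isProbabilityMeasure_law (m := m) (P := P) hε
  have hd := dist_pos_of_ne (v := v) hG
  have hmeas : Measurable fun ω : Sample m k =>
      groupPlays π G v ω.2.1 (privatise ω.1 ω.2.2) n a := by
    simp only [groupPlays, action_eq_act, Finset.card_filter]
    exact Finset.measurable_fun_sum _ fun w _ => Finset.measurable_fun_sum _ fun t _ =>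
      Measurable.ite (measurable_act_sample hd hπ (t, w) (measurableSet_singleton a))
        measurable_const measurable_const
  refine Integrable.of_bound (measurable_from_top.comp hmeas).aestronglyMeasurable (m * n)
    (ae_of_all _ fun ω => ?_)
  rw [Real.norm_natCast]
  have h : groupPlays π G v ω.2.1 (privatise ω.1 ω.2.2) n a ≤ ∑ _w : Fin m, n :=
    Finset.sum_le_sum fun w _ => (Finset.card_filter_le _ _).trans (by simp)
  simp only [Finset.sum_const, Finset.card_univ, Fintype.card_fin, smul_eq_mul] at h
  exact_mod_cast h

/-- The 5 is the 1 from counting beyond U plus the total 4 of the bad-event probabilities. -/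
lemma integral_groupPlays_le {G : SimpleGraph (Fin m)} (hG : G.Connected) (hε : 0 < ε)
    [∀ a, IsProbabilityMeasure (P a)] (hP : ∀ a, ∀ᵐ x ∂(P a), x ∈ Set.Icc (0 : ℝ) 1) {a b : Fin k}
    (hΔ : 0 < ∫ x, x ∂(P b) - ∫ x, x ∂(P a)) (hΔ1 : ∫ x, x ∂(P b) - ∫ x, x ∂(P a) ≤ 1) {n : ℕ}
    (hmn : 1 ≤ m * n) :
    ∫ ω, (groupPlays (ldpUcbL ε) G v ω.2.1 (privatise ω.1 ω.2.2) n a : ℝ) ∂(law m P ε) ≤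
      (16 * ε ^ 2 + 256) / ε ^ 2 * Real.log (m * n) / (∫ x, x ∂(P b) - ∫ x, x ∂(P a)) ^ 2 + 5
        + 2 * ∑ w, (G.dist v w : ℝ) := by
  have hprob := isProbabilityMeasure_law (m := m) (P := P) hε
  have hv : G.dist v v = 0 := SimpleGraph.dist_self
  have hd := dist_pos_of_ne (v := v) hG
  have hπ := measurablePolicy_ldpUcbL (k := k) (ℕ × Fin m × Fin k) ε
  have hbad := measurableSet_badEvent (P := P) (ε := ε) hd hπ n a b
  have hint : ∀ s, Integrable ((badEvent P ε (ldpUcbL ε) (G.dist v) v n a b s).indicator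
      (1 : Sample m k → ℝ)) (law m P ε) := fun s =>
    (integrable_const (1 : ℝ)).indicator (hbad s)
  have hsum : ∑ s ∈ Finset.range (m * n),
      (law m P ε).real (badEvent P ε (ldpUcbL ε) (G.dist v) v n a b s) ≤ 4 := by
    refine (Finset.sum_le_sum fun s _ => law_badEvent_le hε hv hd hπ hP n a b s).trans ?_
    rw [← Finset.mul_sum, Finset.sum_range_sub' (fun s : ℕ => 1 / ((s : ℝ) + 1))]
    have : (0 : ℝ) ≤ 1 / (((m * n : ℕ) : ℝ) + 1) := by positivity
    simp only [Nat.cast_zero, zero_add, div_one]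
    linarith
  refine (integral_mono (integrable_groupPlays hG hε hπ n a)
    ((integrable_const _).add (integrable_finsetSum _ fun s _ => hint s))
    (fun ω => groupPlays_le hG hε hΔ hΔ1 hmn ω)).trans ?_
  simp only [Pi.add_apply]
  rw [integral_add (integrable_const _) (integrable_finsetSum _ fun s _ => hint s),
    integral_finsetSum _ fun s _ => hint s]
  simp only [integral_indicator_one (hbad _), integral_const, probReal_univ, smul_eq_mul, one_mul]
  linarith

lemma gap_nonneg {k : ℕ} (P : Fin k → Measure ℝ) (a : Fin k) : 0 ≤ gap P a :=
  sub_nonneg.2 (le_ciSup (f := fun b => ∫ x, x ∂(P b)) (Set.finite_range _).bddAbove a)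

lemma exists_gap_eq (P : Fin k → Measure ℝ) (a : Fin k) :
    ∃ b, gap P a = ∫ x, x ∂(P b) - ∫ x, x ∂(P a) := by
  obtain ⟨b, hb⟩ := exists_eq_ciSup_of_finite (f := fun b => ∫ x, x ∂(P b))
  exact ⟨b, by rw [gap, ← hb]⟩

lemma gap_le_one [∀ a, IsProbabilityMeasure (P a)]
    (hP : ∀ a, ∀ᵐ x ∂(P a), x ∈ Set.Icc (0 : ℝ) 1) (a : Fin k) : gap P a ≤ 1 := by
  obtain ⟨b, hb⟩ := exists_gap_eq P a
  have h0 : 0 ≤ ∫ x, x ∂(P a) := integral_nonneg_of_ae ((hP a).mono fun x hx => hx.1)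
  have h1 : ∫ x, x ∂(P b) ≤ 1 := by
    have hint : Integrable (fun x => x) (P b) := Integrable.of_bound
      measurable_id.aestronglyMeasurable 1 ((hP b).mono fun x hx => by
        rw [Real.norm_eq_abs, abs_of_nonneg hx.1]; exact hx.2)
    have := integral_mono_ae hint (integrable_const (1 : ℝ)) ((hP b).mono fun x hx => hx.2)
    simpa using this
  linarith

/-- The constant of the regret bound. -/
noncomputable def regretConst (ε₀ : ℝ) : ℝ :=
  16 * ε₀ ^ 2 + 256 + 5 * (ε₀ ^ 2 / Real.log 2) + 2

lemma groupRegret_le {G : SimpleGraph (Fin m)} (hG : G.Connected) {ε₀ : ℝ} (hε : 0 < ε)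
    (hε₀ : ε ≤ ε₀) [∀ a, IsProbabilityMeasure (P a)]
    (hP : ∀ a, ∀ᵐ x ∂(P a), x ∈ Set.Icc (0 : ℝ) 1) {n : ℕ} (hmn : 2 ≤ m * n) :
    groupRegret (ldpUcbL ε) G v P ε n ≤ regretConst ε₀ *
      (∑ a with 0 < gap P a, Real.log (m * n) / (ε ^ 2 * gap P a)
        + (∑ w, (G.dist v w : ℝ)) * ∑ a with 0 < gap P a, gap P a) := by
  have hmn' : (2 : ℝ) ≤ m * n := by exact_mod_cast hmn
  have hL2 : 0 < Real.log 2 := Real.log_pos one_lt_two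
  have hL : Real.log 2 ≤ Real.log (m * n) := Real.log_le_log two_pos hmn'
  have hεsq : ε ^ 2 ≤ ε₀ ^ 2 := by gcongr
  set L := Real.log (m * n) with hLdef
  set D := ∑ w, (G.dist v w : ℝ) with hD
  have hD0 : 0 ≤ D := Finset.sum_nonneg fun _ _ => Nat.cast_nonneg _
  have hfilter : groupRegret (ldpUcbL ε) G v P ε n = ∑ a with 0 < gap P a, gap P a *
      ∫ ω, (groupPlays (ldpUcbL ε) G v ω.2.1 (privatise ω.1 ω.2.2) n a : ℝ) ∂(law m P ε) := by
    refine (Finset.sum_filter_of_ne fun a _ ha => ?_).symm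
    exact (gap_nonneg P a).lt_of_ne' (left_ne_zero_of_mul ha)
  rw [hfilter, Finset.mul_sum, ← Finset.sum_add_distrib, Finset.mul_sum]
  refine Finset.sum_le_sum fun a ha => ?_
  have hΔ := (Finset.mem_filter.1 ha).2
  have hΔ1 := gap_le_one hP a
  obtain ⟨b, hb⟩ := exists_gap_eq P a
  have h := integral_groupPlays_le (v := v) hG hε hP (hb ▸ hΔ) (hb ▸ hΔ1) (by omega : 1 ≤ m * n)
  rw [← hb, ← hLdef, ← hD] at h
  set Δ := gap P a with hΔdef
  refine (mul_le_mul_of_nonneg_left h hΔ.le).trans ?_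
  have hT : 0 < L / (ε ^ 2 * Δ) := div_pos (hL2.trans_le hL) (by positivity)
  have h1 : Δ * ((16 * ε ^ 2 + 256) / ε ^ 2 * L / Δ ^ 2) =
      (16 * ε ^ 2 + 256) * (L / (ε ^ 2 * Δ)) := by
    field_simp
  have h2 : (16 * ε ^ 2 + 256) * (L / (ε ^ 2 * Δ)) ≤ (16 * ε₀ ^ 2 + 256) * (L / (ε ^ 2 * Δ)) := by
    gcongr
  -- Absorbs the additive constant into the logarithmic term, using Δ ≤ 1, ε ≤ ε₀ and log(mn) ≥ log
  -- 2.
  have h3 : Δ ≤ ε₀ ^ 2 / Real.log 2 * (L / (ε ^ 2 * Δ)) := by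
    rw [div_mul_div_comm, le_div_iff₀ (by positivity)]
    have hsq : Δ * Δ ≤ 1 := mul_le_one₀ hΔ1 hΔ.le hΔ1
    calc Δ * (Real.log 2 * (ε ^ 2 * Δ)) = Δ * Δ * (ε ^ 2 * Real.log 2) := by ring
      _ ≤ 1 * (ε₀ ^ 2 * L) := by gcongr
      _ = ε₀ ^ 2 * L := one_mul _
  have h4 : 0 ≤ D * Δ := mul_nonneg hD0 hΔ.le
  have h5 : 0 ≤ (16 * ε₀ ^ 2 + 256 + 5 * (ε₀ ^ 2 / Real.log 2)) * (D * Δ) := by positivity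
  rw [mul_add, mul_add, h1, regretConst]
  nlinarith

end LDP

theorem mainTheorem5 :
    -- the mechanism by which each reward is privatised is `ε`-LDP on `[0, 1]`
    (∀ ε : ℝ, 0 < ε → LDP.IsLDP ε (Set.Icc (0 : ℝ) 1) (LDP.laplaceMechanism ε)) ∧
    -- the whole interaction of QuACK with LDP-UCB-L is `ε`-LDP
    (∀ (m k : ℕ) [NeZero k] (G : SimpleGraph (Fin m)) (v : Fin m) (ε : ℝ), G.Connected → 0 < ε →
      LDP.IsInteractiveLDP ε (LDP.transcriptLaw (k := k) (LDP.ldpUcbL ε) G v ε)) ∧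
    -- group regret
    (∀ ε₀ : ℝ, 0 < ε₀ → ∃ C : ℝ, 0 < C ∧
      ∀ (m k : ℕ) [NeZero k] (G : SimpleGraph (Fin m)) (v : Fin m) (P : Fin k → Measure ℝ)
        (ε : ℝ) (n : ℕ), G.Connected → (∀ a, IsProbabilityMeasure (P a)) →
        (∀ a, ∀ᵐ x ∂(P a), x ∈ Set.Icc (0 : ℝ) 1) → 0 < ε → ε ≤ ε₀ → 2 ≤ m * n →
        (∀ a, Integrable (fun ω => (Quack.groupPlays (LDP.ldpUcbL ε) G v ω.2.1
            (LDP.privatise ω.1 ω.2.2) n a : ℝ)) (LDP.law m P ε)) ∧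
        LDP.groupRegret (LDP.ldpUcbL ε) G v P ε n ≤
          C * (∑ a with 0 < LDP.gap P a, Real.log (m * n) / (ε ^ 2 * LDP.gap P a)
            + (∑ w, (G.dist v w : ℝ)) * ∑ a with 0 < LDP.gap P a, LDP.gap P a)) := by
  refine ⟨fun ε hε => LDP.isLDP_laplaceMechanism hε, fun m k _ G v ε hG hε =>
    LDP.isInteractiveLDP_transcriptLaw (LDP.measurablePolicy_ldpUcbL _ ε) v hG hε,
    fun ε₀ hε₀ => ⟨LDP.regretConst ε₀, ?_, ?_⟩⟩
  · have : 0 < Real.log 2 := Real.log_pos one_lt_two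
    unfold LDP.regretConst
    positivity
  · intro m k _ G v P ε n hG hPr hP hε hεε hmn
    exact ⟨LDP.integrable_groupPlays hG hε (LDP.measurablePolicy_ldpUcbL _ ε) n,
      LDP.groupRegret_le hG hε hεε hP hmn⟩
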